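/- Fix an integer $K\ge 0$ and a probability space. For every $M\ge 1$ let $(H_k)_{k\in\mathbb Z}=(H_k^{(M)})_{k\in\mathbb Z}$ be a family of complex $M\times K$ matrices, and put $H(\nu)=\sum_{k\in\mathbb Z}H_k e^{-2i\pi\nu k}$. Assume, $\|\cdot\|_2$ being the spectral norm of a matrix and the Euclidean norm of a vector, that $$\sup_{M\ge1}\sum_{k\in\mathbb Z}(1+|k|)\,\|H_k\|_2<\infty ,\qquad \lim_{M\to\infty}\max_{1\le m\le M}\max_{\nu\in[0,1]}\|h^m(\nu)\|_2=0 ,$$ where $h^1(\nu),\dots,h^M(\nu)$ are the rows of $H(\nu)$. For every $M\ge 1$ let $(\epsilon_n)_{n\in\mathbb Z}=(\epsilon^{(M)}_n)_{n\in\mathbb Z}$ be a $K$-dimensional standard complex Gaussian white noise (independent $\mathcal N_{\mathbb C^K}(0,I_K)$ circular vectors; the noise may be the same for all $M$, and nothing is assumed on the joint law for different $M$), and let the $M$-dimensional signal $u_n=u_n^{(M)}$ satisfy $u_n=\sum_{k\in\mathbb Z}H_k\epsilon_{n-k}$ with probability one, for every $n\in\mathbb Z$. Let $N=N(M)$ and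 $B=B(M)$ be non-negative integers, $B$ even, such that, as $M\to\infty$, $M=O(N^\alpha)$ for some $\alpha\in(0,1)$, $M/B\to c$ for some $c\in(0,1)$, and $\log N=o(M)$. Put $$\xi_u(\nu)=\frac1{\sqrt N}\sum_{n=0}^{N-1}u_n e^{-2i\pi n\nu},\qquad \hat S_u(\nu)=\frac1{B+1}\sum_{b=-B/2}^{B/2}\xi_u\!\left(\nu+\tfrac bN\right)\xi_u\!\left(\nu+\tfrac bN\right)^* ,$$ and $\mathcal V_N=\{k/N:k=0,\dots,N-1\}$. Then for every $M\ge1$ the process $(u_n)_{n\in\mathbb Z}$ has mean zero, its autocovariance $R_u(\ell)=\mathbb E[u_nu_{n-\ell}^*]$ exists and does not depend on $n$, and its spectral density is $S_u(\nu)=\sum_{\ell\in\mathbb Z}R_u(\ell)e^{-2i\pi\nu\ell}=H(\nu)H(\nu)^*$, a matrix of rank at most $K$, for every real $\nu$; and $$\max_{\nu\in\mathcal V_N}\left\|\hat S_u(\nu)-H(\nu)H(\nu)^*\right\|_2\longrightarrow 0\quad\text{almost surely as } M\to\infty .$$ -/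

import Mathlib

open MeasureTheory ProbabilityTheory Filter Topology Asymptotics
open scoped Matrix Matrix.Norms.L2Operator

/-- The standard circular complex Gaussian law `N_ℂ(0, 1)` : the law of `X + i Y` with `X`, `Y`
independent real centred Gaussian variables of variance `1/2`. -/
noncomputable def stdComplexGaussian : Measure ℂ :=
  ((gaussianReal 0 (1 / 2)).prod (gaussianReal 0 (1 / 2))).map
    (fun p : ℝ × ℝ => (p.1 : ℂ) + (p.2 : ℂ) * Complex.I)

/-- A `K`-dimensional standard complex Gaussian white noise indexed by `ℤ` : all the scalar
variables `ε_{n,i}` are independent with law `N_ℂ(0, 1)`; equivalently, the vectors `ε_n` are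
independent with law `N_{ℂ^K}(0, I_K)`. -/
structure IsComplexGaussianWhiteNoise {Ω : Type*} [MeasurableSpace Ω] {K : ℕ}
    (ε : ℤ → Ω → Fin K → ℂ) (μ : Measure Ω) : Prop where
  law : ∀ n i, HasLaw (fun ω => ε n ω i) stdComplexGaussian μ
  indep : iIndepFun (fun (p : ℤ × Fin K) (ω : Ω) => ε p.1 ω p.2) μ

/-- The process `u` is the output of the filter `(H_k)` driven by `ε` : almost surely,
`u_n = ∑_{k ∈ ℤ} H_k ε_{n-k}`. -/
def IsFilterOutput {Ω : Type*} [MeasurableSpace Ω] {M K : ℕ}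
    (H : ℤ → Matrix (Fin M) (Fin K) ℂ) (ε : ℤ → Ω → Fin K → ℂ)
    (u : ℤ → Ω → Fin M → ℂ) (μ : Measure Ω) : Prop :=
  ∀ n : ℤ, ∀ᵐ ω ∂μ, HasSum (fun k : ℤ => H k *ᵥ ε (n - k) ω) (u n ω)

/-- The transfer function `H(ν) = ∑_{k ∈ ℤ} H_k e^{-2iπνk}` of a filter. -/
noncomputable def transferFunction {M K : ℕ} (H : ℤ → Matrix (Fin M) (Fin K) ℂ) (ν : ℝ) :
    Matrix (Fin M) (Fin K) ℂ :=
  ∑' k : ℤ, Complex.exp (-(2 * (Real.pi : ℂ) * Complex.I * (ν : ℂ) * (k : ℂ))) • H k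

/-- The assumptions on the family of filters `H M : ℤ → ℂ^{M × K}`, `M ≥ 1`; the norm of a matrix
is the spectral norm. -/
structure FilterAssumption {K : ℕ} (H : (M : ℕ) → ℤ → Matrix (Fin M) (Fin K) ℂ) : Prop where
  /-- `sup_{M ≥ 1} ∑_k (1 + |k|) ‖H_k‖₂ < ∞`. -/
  memory : ∃ C : ℝ, ∀ M : ℕ, 1 ≤ M →
    Summable (fun k : ℤ => (1 + |(k : ℝ)|) * ‖H M k‖) ∧
      ∑' k : ℤ, (1 + |(k : ℝ)|) * ‖H M k‖ ≤ C
  /-- The maximum over `m` and `ν ∈ [0, 1]` of the Euclidean norm of the `m`-th row of `H(ν)`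
  tends to zero. -/
  power : Tendsto (fun M : ℕ => ⨆ (m : Fin M) (ν : Set.Icc (0 : ℝ) 1),
    ‖WithLp.toLp 2 (transferFunction (H M) (ν : ℝ) m)‖) atTop (𝓝 0)

/-- The high-dimensional regime for the sample size `N = N(M)` and the (even) smoothing span
`B = B(M)`. -/
structure HighDimRegime (N B : ℕ → ℕ) : Prop where
  even_span : ∀ M, 1 ≤ M → Even (B M)
  /-- `M = O(N^α)` for some `α ∈ (0, 1)`. -/
  dim_isBigO : ∃ α ∈ Set.Ioo (0 : ℝ) 1,
    (fun M : ℕ => (M : ℝ)) =O[atTop] (fun M : ℕ => (N M : ℝ) ^ α)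
  /-- `M / B → c` for some `c ∈ (0, 1)`. -/
  ratio : ∃ c ∈ Set.Ioo (0 : ℝ) 1,
    Tendsto (fun M : ℕ => (M : ℝ) / (B M : ℝ)) atTop (𝓝 c)
  /-- The sample size is subexponential in the dimension : `log N = o(M)`. -/
  log_isLittleO : (fun M : ℕ => Real.log (N M : ℝ)) =o[atTop] (fun M : ℕ => (M : ℝ))

/-- The normalized finite Fourier transform
`ξ_x(ν) = N^{-1/2} ∑_{n=0}^{N-1} x_n e^{-2iπnν}` of a sequence `x` of vectors. -/
noncomputable def finiteFourier {d : ℕ} (N : ℕ) (x : ℤ → Fin d → ℂ) (ν : ℝ) : Fin d → ℂ :=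
  (1 / (Real.sqrt (N : ℝ) : ℂ)) •
    ∑ n ∈ Finset.range N,
      Complex.exp (-(2 * (Real.pi : ℂ) * Complex.I * (n : ℂ) * (ν : ℂ))) • x (n : ℤ)

/-- The frequency-smoothed periodogram
`Ŝ_x(ν) = (B+1)⁻¹ ∑_{b=-B/2}^{B/2} ξ_x(ν + b/N) ξ_x(ν + b/N)^*` with even smoothing span `B`. -/
noncomputable def smoothedPeriodogram {d : ℕ} (N B : ℕ) (x : ℤ → Fin d → ℂ) (ν : ℝ) :
    Matrix (Fin d) (Fin d) ℂ :=
  (1 / ((B : ℂ) + 1)) •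
    ∑ b ∈ Finset.Icc (-((B : ℤ) / 2)) ((B : ℤ) / 2),
      Matrix.vecMulVec (finiteFourier N x (ν + (b : ℝ) / (N : ℝ)))
        (star (finiteFourier N x (ν + (b : ℝ) / (N : ℝ))))

/-- `S` is the spectral density of the zero-mean, second-order stationary process `u` : the
autocovariance matrices `R(ℓ) = E[u_n u_{n-ℓ}^*]` exist and do not depend on `n`, and
`S(ν) = ∑_{ℓ ∈ ℤ} R(ℓ) e^{-2iπνℓ}` for every `ν`. -/
def HasSpectralDensity {Ω : Type*} [MeasurableSpace Ω] {M : ℕ}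
    (u : ℤ → Ω → Fin M → ℂ) (S : ℝ → Matrix (Fin M) (Fin M) ℂ) (μ : Measure Ω) : Prop :=
  (∀ n i, Integrable (fun ω => u n ω i) μ ∧ ∫ ω, u n ω i ∂μ = 0) ∧
  ∃ R : ℤ → Matrix (Fin M) (Fin M) ℂ,
    (∀ n ℓ i j,
      Integrable (fun ω => u n ω i * star (u (n - ℓ) ω j)) μ ∧
        ∫ ω, u n ω i * star (u (n - ℓ) ω j) ∂μ = R ℓ i j) ∧
    ∀ ν : ℝ, HasSum (fun ℓ : ℤ =>
      Complex.exp (-(2 * (Real.pi : ℂ) * Complex.I * (ν : ℂ) * (ℓ : ℂ))) • R ℓ) (S ν)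

/-! The noise dimension `K` is fixed, so the high-dimensional claim reduces to the convergence of
the `K × K` smoothed periodogram of the noise to the identity, together with `ξ_u(ν) ≈ H(ν) ξ_ε(ν)`.

Noise: for a fixed vector `v`, the `B + 1` variables `v^* ξ_ε(ν + b/N)` are exactly independent
circular Gaussians, because the frequencies differ by multiples of `1/N` smaller than one in
absolute value. Hence `v^* Ŝ_ε(ν) v` is a normalized chi-square mean with deviation probability at
most `2 exp(-δ²(B+1)/8)`. A union bound over `N` frequencies costs a factor `N = exp(o(M))`,
harmless since eventually `B > M`; Borel–Cantelli and polarization then give all entries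
(`ae_exists_tendsto_smoothedPeriodogram_sub_one`).

Filter: delaying the noise by `k` multiplies its finite Fourier transform by a phase, up to at most
`2|k|` boundary terms. Since `∑ (1 + |k|) ‖H_k‖` is bounded, `ξ_u - H ξ_ε` is `N^{-1/2}` times a
variable with bounded second moment, uniformly in `ν`; `1/N` is summable over large `M`, so it
vanishes almost surely (`ae_exists_tendsto_finiteFourier_sub`). The same first moment makes `H`
Lipschitz, so across a window of width `B/N → 0` it may be frozen at the centre. A perturbation
bound for rank-one matrices combines the three errors (`norm_smoothedPeriodogram_sub_le`).

The spectral density follows by expanding `u_n u_{n-ℓ}^*` as an absolutely convergent double series,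
integrating termwise, and recognizing the product of the series of `H(ν)` and `H(ν)^*`. -/

/-! ### Chi-square concentration. -/

theorem exp_neg_add_le_one_sub {t : ℝ} (ht : t ≤ 1 / 2) :
    Real.exp (-(t + 2 * t ^ 2)) ≤ 1 - t := by
  have h0 : 0 < 1 - t := by linarith
  rw [← Real.le_log_iff_exp_le h0]
  have h := Real.one_sub_inv_le_log_of_pos h0
  refine le_trans ?_ h
  have : 1 - (1 - t)⁻¹ = -(t + t ^ 2 / (1 - t)) := by field_simp; ring
  rw [this]
  -- This is where `t ≤ 1 / 2` enters: it gives `1 / (1 - t) ≤ 2`.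
  have : t ^ 2 / (1 - t) ≤ 2 * t ^ 2 := by
    rw [div_le_iff₀ h0]; nlinarith [sq_nonneg t]
  linarith

theorem integral_exp_mul_sq_gaussianReal {t : ℝ} (ht : t < 1) :
    ∫ x, Real.exp (t * x ^ 2) ∂(gaussianReal 0 (1 / 2)) = (√(1 - t))⁻¹ := by
  have h0 : 0 < 1 - t := by linarith
  rw [integral_gaussianReal_eq_integral_smul (by norm_num)]
  have : ∀ x : ℝ, gaussianPDFReal 0 (1 / 2) x • Real.exp (t * x ^ 2)
      = (√Real.pi)⁻¹ * Real.exp (-(1 - t) * x ^ 2) := by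
    intro x
    simp only [gaussianPDFReal, smul_eq_mul]
    rw [mul_assoc, ← Real.exp_add]
    have : ((1 / 2 : NNReal) : ℝ) = 1 / 2 := by norm_num
    rw [this]
    congr 2
    · congr 1; ring
    · ring
  simp_rw [this]
  rw [integral_const_mul, integral_gaussian, Real.sqrt_div Real.pi_pos.le]
  have := (Real.sqrt_pos.2 Real.pi_pos).ne'
  have := (Real.sqrt_pos.2 h0).ne'
  field_simp

/-- A non-integrable function has Bochner integral `0`, whereas the computed value is positive. -/
theorem integrable_exp_mul_sq_gaussianReal {t : ℝ} (ht : t < 1) :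
    Integrable (fun x => Real.exp (t * x ^ 2)) (gaussianReal 0 (1 / 2)) := by
  by_contra h
  have h1 := integral_exp_mul_sq_gaussianReal ht
  rw [integral_undef h] at h1
  have : 0 < 1 - t := by linarith
  have := Real.sqrt_pos.2 this
  have := inv_pos.2 this
  linarith

section ChiSquare

variable {Ω : Type*} [MeasurableSpace Ω] {μ : Measure Ω}

/-- The exact value `(1 - t)^{-1/2}` is traded for a quadratic exponent valid for both signs of `t`,
so that it serves both tails. -/
theorem mgf_sq_le {Y : Ω → ℝ} (hY : HasLaw Y (gaussianReal 0 (1 / 2)) μ) {t : ℝ}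
    (ht : t ≤ 1 / 2) :
    mgf (fun ω => Y ω ^ 2) μ t ≤ Real.exp ((t + 2 * t ^ 2) / 2) := by
  have h1 : mgf (fun ω => Y ω ^ 2) μ t = (√(1 - t))⁻¹ := by
    rw [← integral_exp_mul_sq_gaussianReal (by linarith), mgf]
    exact hY.integral_comp (f := fun x => Real.exp (t * x ^ 2)) (by fun_prop)
  rw [h1, show (t + 2 * t ^ 2) / 2 = -(-(t + 2 * t ^ 2) / 2) by ring, Real.exp_neg]
  gcongr
  rw [Real.exp_half]
  exact Real.sqrt_le_sqrt (exp_neg_add_le_one_sub ht)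

theorem integrable_exp_mul_sq {Y : Ω → ℝ} (hY : HasLaw Y (gaussianReal 0 (1 / 2)) μ) {t : ℝ}
    (ht : t < 1) : Integrable (fun ω => Real.exp (t * Y ω ^ 2)) μ := by
  have := integrable_exp_mul_sq_gaussianReal ht
  rw [← hY.map_eq] at this
  exact this.comp_aemeasurable hY.aemeasurable

variable {κ : Type*} [Fintype κ]

theorem mgf_sum_sq_le {Y : κ → Ω → ℝ} (hY : ∀ i, HasLaw (Y i) (gaussianReal 0 (1 / 2)) μ)
    (hind : iIndepFun Y μ) {t : ℝ} (ht : t ≤ 1 / 2) :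
    Integrable (fun ω => Real.exp (t * ∑ i, Y i ω ^ 2)) μ ∧
    mgf (fun ω => ∑ i, Y i ω ^ 2) μ t ≤
      Real.exp ((t + 2 * t ^ 2) * (Fintype.card κ / 2)) := by
  have hp := hind.isProbabilityMeasure
  have hind2 : iIndepFun (fun i ω => Y i ω ^ 2) μ :=
    hind.comp (fun _ x => x ^ 2) (fun _ => by fun_prop)
  have hm : ∀ i, AEMeasurable (fun ω => Y i ω ^ 2) μ := fun i =>
    (hY i).aemeasurable.pow_const 2
  have hs : (fun ω => ∑ i, Y i ω ^ 2) = ∑ i, (fun ω => Y i ω ^ 2) := by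
    ext ω; simp
  constructor
  · by_contra hni
    have h0 : mgf (fun ω => ∑ i, Y i ω ^ 2) μ t = 0 := integral_undef hni
    rw [hs, hind2.mgf_sum₀ hm] at h0
    have h1 : 0 < ∏ i, mgf (fun ω => Y i ω ^ 2) μ t :=
      Finset.prod_pos fun i _ => mgf_pos (integrable_exp_mul_sq (hY i) (by linarith))
    exact h1.ne' h0
  · rw [hs, hind2.mgf_sum₀ hm]
    calc ∏ i, mgf (fun ω => Y i ω ^ 2) μ t ≤ ∏ _i : κ, Real.exp ((t + 2 * t ^ 2) / 2) :=
          Finset.prod_le_prod (fun i _ => mgf_nonneg) (fun i _ => mgf_sq_le (hY i) ht)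
      _ = _ := by
          rw [Finset.prod_const, ← Real.exp_nat_mul, Finset.card_univ]
          congr 1; ring

/-- Chernoff bound for the mean of the squares of independent centred Gaussian variables. -/
theorem measureReal_abs_sum_sq_sub_ge_le {Y : κ → Ω → ℝ}
    (hY : ∀ i, HasLaw (Y i) (gaussianReal 0 (1 / 2)) μ) (hind : iIndepFun Y μ) {m δ : ℝ}
    (hm : (Fintype.card κ : ℝ) = 2 * m) (hδ : 0 ≤ δ) (hδ1 : δ ≤ 1) :
    μ.real {ω | δ * m ≤ |∑ i, Y i ω ^ 2 - m|} ≤ 2 * Real.exp (-(δ ^ 2 / 8) * m) := by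
  have hp := hind.isProbabilityMeasure
  have hcard : (Fintype.card κ / 2 : ℝ) = m := by rw [hm]; ring
  have hup : μ.real {ω | (1 + δ) * m ≤ ∑ i, Y i ω ^ 2} ≤ Real.exp (-(δ ^ 2 / 8) * m) := by
    -- The Chernoff exponent is `(2 t² - δ t) m`, minimal at `t = δ / 4` with value `-δ² m / 8`.
    obtain ⟨hi, hb⟩ := mgf_sum_sq_le hY hind (t := δ / 4) (by linarith)
    refine (measure_ge_le_exp_mul_mgf ((1 + δ) * m) (by linarith : 0 ≤ δ / 4) hi).trans ?_
    refine (mul_le_mul_of_nonneg_left hb (Real.exp_pos _).le).trans ?_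
    rw [← Real.exp_add, hcard]
    apply le_of_eq; congr 1; ring
  have hlo : μ.real {ω | ∑ i, Y i ω ^ 2 ≤ (1 - δ) * m} ≤ Real.exp (-(δ ^ 2 / 8) * m) := by
    obtain ⟨hi, hb⟩ := mgf_sum_sq_le hY hind (t := -(δ / 4)) (by linarith)
    refine (measure_le_le_exp_mul_mgf ((1 - δ) * m) (by linarith : -(δ / 4) ≤ 0) hi).trans ?_
    refine (mul_le_mul_of_nonneg_left hb (Real.exp_pos _).le).trans ?_
    rw [← Real.exp_add, hcard]
    apply le_of_eq; congr 1; ring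
  calc μ.real {ω | δ * m ≤ |∑ i, Y i ω ^ 2 - m|}
      ≤ μ.real ({ω | (1 + δ) * m ≤ ∑ i, Y i ω ^ 2} ∪ {ω | ∑ i, Y i ω ^ 2 ≤ (1 - δ) * m}) := by
        apply measureReal_mono _ (measure_ne_top _ _)
        intro ω hω
        simp only [Set.mem_ofPred_eq, Set.mem_union] at hω ⊢
        rcases le_abs.1 hω with h | h
        · left; linarith
        · right; linarith
    _ ≤ _ := (measureReal_union_le _ _).trans (by linarith)

end ChiSquare

/-! ### Moments of the standard circular complex Gaussian law. -/

section ComplexGaussian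

theorem stdComplexGaussian_eq_map : stdComplexGaussian =
    ((gaussianReal 0 (1 / 2)).prod (gaussianReal 0 (1 / 2))).map
      (Complex.equivRealProdCLM.symm : ℝ × ℝ → ℂ) := by
  unfold stdComplexGaussian
  congr 1
  ext p
  simp [Complex.equivRealProdCLM_symm_apply]

instance isGaussian_stdComplexGaussian : IsGaussian stdComplexGaussian := by
  rw [stdComplexGaussian_eq_map]
  infer_instance

theorem integrable_stdComplexGaussian : Integrable (fun z : ℂ => z) stdComplexGaussian :=
  IsGaussian.integrable_id

theorem memLp_two_stdComplexGaussian : MemLp (fun z : ℂ => z) 2 stdComplexGaussian :=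
  IsGaussian.memLp_two_id

theorem integral_stdComplexGaussian_eq {E : Type*} [NormedAddCommGroup E] [NormedSpace ℝ E]
    (f : ℂ → E) (hf : Continuous f) : ∫ z, f z ∂stdComplexGaussian =
    ∫ p : ℝ × ℝ, f (p.1 + p.2 * Complex.I)
      ∂((gaussianReal 0 (1 / 2)).prod (gaussianReal 0 (1 / 2))) := by
  unfold stdComplexGaussian
  rw [integral_map (by fun_prop) hf.aestronglyMeasurable]

theorem integral_sq_gaussianReal (v : NNReal) :
    ∫ x : ℝ, x ^ 2 ∂(gaussianReal 0 v) = v := by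
  have := variance_id_gaussianReal (μ := 0) (v := v)
  rw [variance_eq_integral (by fun_prop)] at this
  simpa using this

theorem integral_self_stdComplexGaussian : ∫ z, z ∂stdComplexGaussian = 0 := by
  have hre : ∫ z, z.re ∂stdComplexGaussian = 0 := by
    rw [integral_stdComplexGaussian_eq _ Complex.continuous_re]
    have := integral_fun_fst (μ := gaussianReal 0 (1 / 2)) (ν := gaussianReal 0 (1 / 2))
      (fun x : ℝ => x)
    simp only [Complex.add_re, Complex.ofReal_re, Complex.mul_re, Complex.I_re, mul_zero,
      Complex.ofReal_im, Complex.I_im, mul_one, sub_self, add_zero]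
    rw [this]; simp
  have him : ∫ z, z.im ∂stdComplexGaussian = 0 := by
    rw [integral_stdComplexGaussian_eq _ Complex.continuous_im]
    have := integral_fun_snd (μ := gaussianReal 0 (1 / 2)) (ν := gaussianReal 0 (1 / 2))
      (fun x : ℝ => x)
    simp only [Complex.add_im, Complex.ofReal_re, Complex.mul_im, Complex.I_re, mul_zero,
      Complex.ofReal_im, Complex.I_im, mul_one, zero_add, add_zero]
    rw [this]; simp
  apply Complex.ext
  · exact (integral_re (𝕜 := ℂ) integrable_stdComplexGaussian).symm.trans hre
  · exact (integral_im (𝕜 := ℂ) integrable_stdComplexGaussian).symm.trans him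

theorem integral_re_mul_self_stdComplexGaussian :
    ∫ z, z.re ^ 2 ∂stdComplexGaussian = 1 / 2 := by
  rw [integral_stdComplexGaussian_eq _ (by fun_prop)]
  have := integral_fun_fst (μ := gaussianReal 0 (1 / 2)) (ν := gaussianReal 0 (1 / 2))
    (fun x : ℝ => x ^ 2)
  simp only [Complex.add_re, Complex.ofReal_re, Complex.mul_re, Complex.I_re, mul_zero,
    Complex.ofReal_im, Complex.I_im, mul_one, sub_self, add_zero]
  rw [this, integral_sq_gaussianReal]; simp

theorem integral_im_mul_self_stdComplexGaussian :
    ∫ z, z.im ^ 2 ∂stdComplexGaussian = 1 / 2 := by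
  rw [integral_stdComplexGaussian_eq _ (by fun_prop)]
  have := integral_fun_snd (μ := gaussianReal 0 (1 / 2)) (ν := gaussianReal 0 (1 / 2))
    (fun x : ℝ => x ^ 2)
  simp only [Complex.add_im, Complex.ofReal_re, Complex.mul_im, Complex.I_re, mul_zero,
    Complex.ofReal_im, Complex.I_im, mul_one, zero_add, add_zero]
  rw [this, integral_sq_gaussianReal]; simp

theorem integral_re_mul_im_stdComplexGaussian :
    ∫ z, z.re * z.im ∂stdComplexGaussian = 0 := by
  rw [integral_stdComplexGaussian_eq _ (by fun_prop)]
  have := integral_prod_mul (μ := gaussianReal 0 (1 / 2)) (ν := gaussianReal 0 (1 / 2))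
    (fun x : ℝ => x) (fun x : ℝ => x)
  simp only [Complex.add_re, Complex.mul_re, sub_self, Complex.add_im, Complex.ofReal_re,
    Complex.mul_im, Complex.I_re, mul_zero, Complex.ofReal_im, Complex.I_im, mul_one, zero_add,
    add_zero]
  rw [this]
  simp

theorem integrable_mul_self_stdComplexGaussian :
    Integrable (fun z : ℂ => z * z) stdComplexGaussian :=
  memLp_two_stdComplexGaussian.integrable_mul memLp_two_stdComplexGaussian

theorem integral_mul_self_stdComplexGaussian : ∫ z, z * z ∂stdComplexGaussian = 0 := by
  have hi := integrable_mul_self_stdComplexGaussian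
  have hre : MemLp (fun z : ℂ => z.re) 2 stdComplexGaussian := memLp_two_stdComplexGaussian.re
  have him : MemLp (fun z : ℂ => z.im) 2 stdComplexGaussian := memLp_two_stdComplexGaussian.im
  apply Complex.ext
  · refine (integral_re (𝕜 := ℂ) hi).symm.trans ?_
    simp only [RCLike.re_to_complex, Complex.mul_re]
    simp only [← pow_two]
    rw [integral_sub hre.integrable_sq him.integrable_sq,
      integral_re_mul_self_stdComplexGaussian, integral_im_mul_self_stdComplexGaussian]
    simp
  · refine (integral_im (𝕜 := ℂ) hi).symm.trans ?_
    simp only [RCLike.im_to_complex, Complex.mul_im]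
    have : ∀ z : ℂ, z.re * z.im + z.im * z.re = 2 * (z.re * z.im) := fun z => by ring
    simp_rw [this]
    rw [integral_const_mul, integral_re_mul_im_stdComplexGaussian]; simp

theorem integral_mul_star_stdComplexGaussian : ∫ z, z * star z ∂stdComplexGaussian = 1 := by
  have hre : MemLp (fun z : ℂ => z.re) 2 stdComplexGaussian := memLp_two_stdComplexGaussian.re
  have him : MemLp (fun z : ℂ => z.im) 2 stdComplexGaussian := memLp_two_stdComplexGaussian.im
  have : ∀ z : ℂ, z * star z = ((z.re ^ 2 + z.im ^ 2 : ℝ) : ℂ) := by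
    intro z
    rw [Complex.star_def, Complex.mul_conj, Complex.normSq_apply]; congr 1; ring
  simp_rw [this]
  rw [integral_complex_ofReal, integral_add hre.integrable_sq him.integrable_sq,
      integral_re_mul_self_stdComplexGaussian, integral_im_mul_self_stdComplexGaussian]
  norm_num

end ComplexGaussian

/-! ### Orthogonal linear combinations of a white noise. -/

section Whitening

variable {Ω : Type*} [MeasurableSpace Ω] {μ : Measure Ω} {ι : Type*} {X : ι → Ω → ℂ}

theorem memLp_two_of_hasLaw {Z : Ω → ℂ} (hZ : HasLaw Z stdComplexGaussian μ) : MemLp Z 2 μ :=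
  hZ.hasGaussianLaw.memLp_two

theorem integral_eq_zero_of_hasLaw {Z : Ω → ℂ} (hZ : HasLaw Z stdComplexGaussian μ) :
    ∫ ω, Z ω ∂μ = 0 :=
  hZ.integral_eq.trans integral_self_stdComplexGaussian

/-- The diagonal case is circularity, `E[Z²] = 0`; the pseudo-covariance must vanish for real and
imaginary parts to decouple. -/
theorem integral_mul_of_iIndepFun (hX : ∀ s, HasLaw (X s) stdComplexGaussian μ)
    (hind : iIndepFun X μ) (s t : ι) : ∫ ω, X s ω * X t ω ∂μ = 0 := by
  by_cases hst : s = t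
  · subst hst
    exact ((hX s).integral_comp (f := fun z => z * z) (by fun_prop)).trans
      integral_mul_self_stdComplexGaussian
  · rw [(hind.indepFun hst).integral_fun_mul_eq_mul_integral
      (hX s).aemeasurable.aestronglyMeasurable (hX t).aemeasurable.aestronglyMeasurable,
      integral_eq_zero_of_hasLaw (hX s), zero_mul]

theorem integral_mul_star_of_iIndepFun [DecidableEq ι]
    (hX : ∀ s, HasLaw (X s) stdComplexGaussian μ)
    (hind : iIndepFun X μ) (s t : ι) :
    ∫ ω, X s ω * star (X t ω) ∂μ = if s = t then 1 else 0 := by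
  by_cases hst : s = t
  · subst hst
    rw [if_pos rfl]
    exact ((hX s).integral_comp (f := fun z => z * star z)
      (by fun_prop)).trans integral_mul_star_stdComplexGaussian
  · have h := (hind.indepFun hst).comp (φ := id) (ψ := star) measurable_id continuous_star.measurable
    rw [if_neg hst]
    have := h.integral_fun_mul_eq_mul_integral
      (hX s).aemeasurable.aestronglyMeasurable
      (continuous_star.measurable.comp_aemeasurable (hX t).aemeasurable).aestronglyMeasurable
    simp only [Function.comp_apply, id] at this
    rw [this, integral_eq_zero_of_hasLaw (hX s), zero_mul]

variable [Fintype ι]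

theorem memLp_two_sum_mul (hX : ∀ s, HasLaw (X s) stdComplexGaussian μ) (a : ι → ℂ) :
    MemLp (fun ω => ∑ s, a s * X s ω) 2 μ :=
  memLp_finsetSum _ fun s _ => (memLp_two_of_hasLaw (hX s)).const_mul (a s)

theorem integral_sum_mul (hX : ∀ s, HasLaw (X s) stdComplexGaussian μ)
    (a : ι → ℂ) : ∫ ω, ∑ s, a s * X s ω ∂μ = 0 := by
  rw [integral_finsetSum _ fun s _ => (hX s).hasGaussianLaw.integrable.const_mul (a s)]
  simp_rw [integral_const_mul, fun s => integral_eq_zero_of_hasLaw (hX s)]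
  simp

theorem integral_sum_mul_sum (hX : ∀ s, HasLaw (X s) stdComplexGaussian μ)
    (hind : iIndepFun X μ) (a b : ι → ℂ) :
    ∫ ω, (∑ s, a s * X s ω) * (∑ s, b s * X s ω) ∂μ = 0 := by
  have hi : ∀ s t, Integrable (fun ω => a s * X s ω * (b t * X t ω)) μ := fun s t =>
    ((memLp_two_of_hasLaw (hX s)).const_mul (a s)).integrable_mul
      ((memLp_two_of_hasLaw (hX t)).const_mul (b t))
  simp_rw [Finset.sum_mul_sum]
  rw [integral_finsetSum _ fun s _ => integrable_finsetSum _ fun t _ => hi s t]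
  refine Finset.sum_eq_zero fun s _ => ?_
  rw [integral_finsetSum _ fun t _ => hi s t]
  refine Finset.sum_eq_zero fun t _ => ?_
  simp_rw [fun ω => mul_mul_mul_comm (a s) (X s ω) (b t) (X t ω)]
  rw [integral_const_mul, integral_mul_of_iIndepFun hX hind, mul_zero]

theorem integral_sum_mul_star_sum (hX : ∀ s, HasLaw (X s) stdComplexGaussian μ)
    (hind : iIndepFun X μ) (a b : ι → ℂ) :
    ∫ ω, (∑ s, a s * X s ω) * star (∑ s, b s * X s ω) ∂μ = ∑ s, a s * star (b s) := by
  classical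
  have hi : ∀ s t, Integrable (fun ω => a s * X s ω * star (b t * X t ω)) μ := fun s t =>
    ((memLp_two_of_hasLaw (hX s)).const_mul (a s)).integrable_mul
      ((memLp_two_of_hasLaw (hX t)).const_mul (b t)).star
  simp_rw [star_sum, Finset.sum_mul_sum]
  rw [integral_finsetSum _ fun s _ => integrable_finsetSum _ fun t _ => hi s t]
  refine Finset.sum_congr rfl fun s _ => ?_
  rw [integral_finsetSum _ fun t _ => hi s t]
  have : ∀ t, ∫ ω, a s * X s ω * star (b t * X t ω) ∂μ =
      if s = t then a s * star (b t) else 0 := by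
    intro t
    simp_rw [star_mul', fun ω => mul_mul_mul_comm (a s) (X s ω) (star (b t)) (star (X t ω))]
    rw [integral_const_mul, integral_mul_star_of_iIndepFun hX hind]
    simp
  simp_rw [this]
  simp

/-- The real part (`true`) or the imaginary part (`false`) of a complex number. -/
noncomputable def realPartOf (r : Bool) : ℂ →L[ℝ] ℝ := bif r then Complex.reCLM else Complex.imCLM

theorem sum_realPartOf_sq {β : Type*} [Fintype β] (z : β → ℂ) :
    ∑ p : β × Bool, (realPartOf p.2 (z p.1)) ^ 2 = ∑ b, ‖z b‖ ^ 2 := by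
  rw [Fintype.sum_prod_type]
  refine Finset.sum_congr rfl fun b _ => ?_
  rw [← Complex.normSq_eq_norm_sq, Complex.normSq_apply]
  simp [realPartOf]; ring

/-- Each product of real or imaginary parts is half a signed sum of the real or imaginary parts of
`Z W` and `Z W̄`. The mixed ones average to zero because `c` is real. -/
theorem integral_realPartOf_mul {Z W : Ω → ℂ} (hZ : MemLp Z 2 μ) (hW : MemLp W 2 μ)
    (h0 : ∫ ω, Z ω * W ω ∂μ = 0) {c : ℝ} (h1 : ∫ ω, Z ω * star (W ω) ∂μ = c) (r s : Bool) :
    ∫ ω, realPartOf r (Z ω) * realPartOf s (W ω) ∂μ = if r = s then c / 2 else 0 := by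
  have i0 : Integrable (fun ω => Z ω * W ω) μ := hZ.integrable_mul hW
  have i1 : Integrable (fun ω => Z ω * star (W ω)) μ := hZ.integrable_mul hW.star
  have key : ∀ a b : ℝ, ∫ ω, (a * (Z ω * W ω).re + b * (Z ω * star (W ω)).re) ∂μ = b * c := by
    intro a b
    have e0 : ∫ ω, (Z ω * W ω).re ∂μ = 0 :=
      (integral_re (𝕜 := ℂ) i0).trans (by rw [h0]; simp)
    have e1 : ∫ ω, (Z ω * star (W ω)).re ∂μ = c :=
      (integral_re (𝕜 := ℂ) i1).trans (by rw [h1]; simp)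
    have j0 : Integrable (fun ω => (Z ω * W ω).re) μ := i0.re
    have j1 : Integrable (fun ω => (Z ω * star (W ω)).re) μ := i1.re
    rw [integral_add (j0.const_mul a) (j1.const_mul b), integral_const_mul,
      integral_const_mul, e0, e1]; simp
  have key' : ∀ a b : ℝ, ∫ ω, (a * (Z ω * W ω).im + b * (Z ω * star (W ω)).im) ∂μ = 0 := by
    intro a b
    have e0 : ∫ ω, (Z ω * W ω).im ∂μ = 0 :=
      (integral_im (𝕜 := ℂ) i0).trans (by rw [h0]; simp)
    have e1 : ∫ ω, (Z ω * star (W ω)).im ∂μ = 0 :=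
      (integral_im (𝕜 := ℂ) i1).trans (by rw [h1]; simp)
    have j0 : Integrable (fun ω => (Z ω * W ω).im) μ := i0.im
    have j1 : Integrable (fun ω => (Z ω * star (W ω)).im) μ := i1.im
    rw [integral_add (j0.const_mul a) (j1.const_mul b), integral_const_mul,
      integral_const_mul, e0, e1]; simp
  cases r <;> cases s
  · rw [if_pos rfl, show c / 2 = 1 / 2 * c by ring, ← key (-(1 / 2)) (1 / 2)]
    congr 1; ext ω; simp [realPartOf]; ring
  · rw [if_neg (by simp), ← key' (1 / 2) (1 / 2)]
    congr 1; ext ω; simp [realPartOf]; ring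
  · rw [if_neg (by simp), ← key' (1 / 2) (-(1 / 2))]
    congr 1; ext ω; simp [realPartOf]; ring
  · rw [if_pos rfl, show c / 2 = 1 / 2 * c by ring, ← key (1 / 2) (1 / 2)]
    congr 1; ext ω; simp [realPartOf]; ring

variable {β : Type*} [Fintype β]

theorem hasGaussianLaw_realPartOf_sum_mul (hX : ∀ s, HasLaw (X s) stdComplexGaussian μ)
    (hind : iIndepFun X μ) (A : β → ι → ℂ) :
    HasGaussianLaw (fun ω => fun p : β × Bool => realPartOf p.2 (∑ s, A p.1 s * X s ω)) μ := by
  have h := iIndepFun.hasGaussianLaw (fun s => (hX s).hasGaussianLaw) hind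
  let L : (ι → ℂ) →L[ℝ] (β × Bool → ℝ) := ContinuousLinearMap.pi fun p =>
    (realPartOf p.2).comp (∑ s, (ContinuousLinearMap.mul ℝ ℂ (A p.1 s)).comp
      (ContinuousLinearMap.proj s))
  have h2 : (fun ω => fun p : β × Bool => realPartOf p.2 (∑ s, A p.1 s * X s ω)) =
      fun ω => L (fun s => X s ω) := by
    ext ω p
    simp [L]
  rw [h2]
  exact h.map_fun L

variable [DecidableEq β]

/-- An isometric image of a complex Gaussian white noise is a white noise. -/
theorem iIndepFun_realPartOf_sum_mul (hX : ∀ s, HasLaw (X s) stdComplexGaussian μ)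
    (hind : iIndepFun X μ) (A : β → ι → ℂ)
    (hA : ∀ b b', ∑ s, A b s * star (A b' s) = if b = b' then 1 else 0) :
    iIndepFun (fun (p : β × Bool) ω => realPartOf p.2 (∑ s, A p.1 s * X s ω)) μ ∧
    ∀ p : β × Bool, HasLaw (fun ω => realPartOf p.2 (∑ s, A p.1 s * X s ω))
      (gaussianReal 0 (1 / 2)) μ := by
  have hp := hind.isProbabilityMeasure
  have hG := hasGaussianLaw_realPartOf_sum_mul hX hind A
  have h2 := fun b => memLp_two_sum_mul hX (A b)
  have hmean : ∀ p : β × Bool, ∫ ω, realPartOf p.2 (∑ s, A p.1 s * X s ω) ∂μ = 0 := by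
    intro p
    rw [ContinuousLinearMap.integral_comp_comm _ ((h2 p.1).integrable one_le_two),
      integral_sum_mul hX]; simp
  have hcov : ∀ p q : β × Bool, cov[fun ω => realPartOf p.2 (∑ s, A p.1 s * X s ω),
      fun ω => realPartOf q.2 (∑ s, A q.1 s * X s ω); μ] = if p = q then 1 / 2 else 0 := by
    intro p q
    rw [covariance_eq_sub (hG.eval p).memLp_two (hG.eval q).memLp_two, hmean, hmean]
    have := integral_realPartOf_mul (h2 p.1) (h2 q.1) (integral_sum_mul_sum hX hind _ _)
      (c := if p.1 = q.1 then 1 else 0)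
      ((integral_sum_mul_star_sum hX hind _ _).trans (by rw [hA]; split_ifs <;> simp)) p.2 q.2
    simp only [Pi.mul_apply]
    rw [this]
    obtain ⟨p1, p2⟩ := p
    obtain ⟨q1, q2⟩ := q
    by_cases h1 : p1 = q1 <;> by_cases h2 : p2 = q2 <;> simp [h1, h2]
  refine ⟨hG.iIndepFun_of_covariance_eq_zero fun p q hpq => by rw [hcov, if_neg hpq], fun p =>
    ⟨(hG.eval p).aemeasurable, ?_⟩⟩
  rw [(hG.eval p).map_eq_gaussianReal, hmean, ← covariance_self (hG.eval p).aemeasurable, hcov,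
    if_pos rfl]
  congr 1
  ext; norm_num

/-- Dividing the rows by `√σ` makes them orthonormal, so the real and imaginary parts form `2 * card
β` independent Gaussians of variance `1 / 2` and the chi-square bound applies with `m = card β`. -/
theorem measureReal_abs_sum_norm_sq_sub_ge_le (hX : ∀ s, HasLaw (X s) stdComplexGaussian μ)
    (hind : iIndepFun X μ) (A : β → ι → ℂ) {σ : ℝ} (hσ : 0 < σ)
    (hA : ∀ b b', ∑ s, A b s * star (A b' s) = if b = b' then (σ : ℂ) else 0)
    {δ : ℝ} (hδ : 0 ≤ δ) (hδ1 : δ ≤ 1) :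
    μ.real {ω | δ * σ * Fintype.card β ≤ |∑ b, ‖∑ s, A b s * X s ω‖ ^ 2 - σ * Fintype.card β|} ≤
      2 * Real.exp (-(δ ^ 2 / 8) * Fintype.card β) := by
  have hs := Real.sqrt_pos.2 hσ
  have hsq : ((√σ : ℝ) : ℂ) * ((√σ : ℝ) : ℂ) = σ := by
    rw [← Complex.ofReal_mul, Real.mul_self_sqrt hσ.le]
  have hsc : ((√σ : ℝ) : ℂ) ≠ 0 := by exact_mod_cast hs.ne'
  obtain ⟨h1, h2⟩ := iIndepFun_realPartOf_sum_mul hX hind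
    (fun b s => ((√σ : ℝ) : ℂ)⁻¹ * A b s) (fun b b' => by
      have : ∀ s, ((√σ : ℝ) : ℂ)⁻¹ * A b s * star (((√σ : ℝ) : ℂ)⁻¹ * A b' s) =
          (σ : ℂ)⁻¹ * (A b s * star (A b' s)) := by
        intro s
        rw [star_mul', ← hsq]
        simp only [Complex.star_def, map_inv₀, Complex.conj_ofReal]
        field_simp
      simp_rw [this]
      rw [← Finset.mul_sum, hA]
      have : (σ : ℂ) ≠ 0 := by exact_mod_cast hσ.ne'
      split_ifs <;> simp [this])
  have h3 := measureReal_abs_sum_sq_sub_ge_le h2 h1 (m := Fintype.card β) (δ := δ)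
    (by simp [mul_comm]) hδ hδ1
  refine le_trans (le_of_eq ?_) h3
  congr 1
  ext ω
  simp only [Set.mem_ofPred_eq]
  rw [sum_realPartOf_sq (fun b => ∑ s, ((√σ : ℝ) : ℂ)⁻¹ * A b s * X s ω)]
  have : ∀ b, ‖∑ s, ((√σ : ℝ) : ℂ)⁻¹ * A b s * X s ω‖ ^ 2 =
      σ⁻¹ * ‖∑ s, A b s * X s ω‖ ^ 2 := by
    intro b
    simp_rw [mul_assoc]
    rw [← Finset.mul_sum, norm_mul, mul_pow, norm_inv, Complex.norm_real, Real.norm_of_nonneg hs.le,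
      inv_pow, Real.sq_sqrt hσ.le]
  simp_rw [this]
  rw [← Finset.mul_sum]
  have e : ∑ b, ‖∑ s, A b s * X s ω‖ ^ 2 - σ * Fintype.card β =
      σ * (σ⁻¹ * ∑ b, ‖∑ s, A b s * X s ω‖ ^ 2 - Fintype.card β) := by
    field_simp
  rw [e, abs_mul, abs_of_pos hσ, show δ * σ * Fintype.card β = σ * (δ * Fintype.card β) by ring]
  exact mul_le_mul_iff_right₀ hσ

end Whitening

/-! ### Consequences of the asymptotic regime. -/

section Regime

variable {N B : ℕ → ℕ}

/-- The exponent is `p = 1 / α`; being larger than one, it makes the bound on `1 / N` summable in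
`M`. -/
theorem HighDimRegime.eventually_inv_le (h : HighDimRegime N B) :
    ∃ p > (1 : ℝ), ∃ C : ℝ, 0 ≤ C ∧ ∀ᶠ M in atTop, 0 < N M ∧ (N M : ℝ)⁻¹ ≤ C * (M : ℝ) ^ (-p) := by
  obtain ⟨α, ⟨hα0, hα1⟩, hO⟩ := h.dim_isBigO
  obtain ⟨c, hc0, hc⟩ := hO.exists_pos
  refine ⟨α⁻¹, (one_lt_inv₀ hα0).2 hα1, c ^ α⁻¹, by positivity, ?_⟩
  filter_upwards [hc.bound, eventually_ge_atTop 1] with M hM hM1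
  have hMpos : (0 : ℝ) < M := by exact_mod_cast hM1
  rw [Real.norm_of_nonneg hMpos.le, Real.norm_of_nonneg (by positivity)] at hM
  have hN : 0 < N M := by
    rcases Nat.eq_zero_or_pos (N M) with h0 | h0
    · rw [h0, Nat.cast_zero, Real.zero_rpow hα0.ne', mul_zero] at hM; linarith
    · exact h0
  have hNr : (0 : ℝ) < N M := by exact_mod_cast hN
  refine ⟨hN, ?_⟩
  have h1 := Real.rpow_le_rpow hMpos.le hM (inv_pos.2 hα0).le
  rw [Real.mul_rpow hc0.le (by positivity), ← Real.rpow_mul hNr.le, mul_inv_cancel₀ hα0.ne',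
    Real.rpow_one] at h1
  rw [Real.rpow_neg hMpos.le, ← div_eq_mul_inv, inv_le_comm₀ hNr (by positivity), inv_div]
  rwa [div_le_iff₀ (by positivity), mul_comm]

theorem HighDimRegime.eventually_lt_span (h : HighDimRegime N B) :
    ∀ᶠ M in atTop, M < B M := by
  obtain ⟨c, ⟨hc0, hc1⟩, hc⟩ := h.ratio
  -- The lower bound excludes `B M = 0`, for which the quotient is `0` by convention.
  filter_upwards [hc.eventually_lt_const hc1, hc.eventually_const_lt hc0] with M h1 h2
  have hB : (0 : ℝ) < B M := by
    rcases Nat.eq_zero_or_pos (B M) with h0 | h0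
    · rw [h0] at h2; simp at h2
    · exact_mod_cast h0
  rw [div_lt_one hB] at h1
  exact_mod_cast h1

/-- Eventually `B ≤ 2 M / c` and `1 / N ≤ C M^{-p}`, so the ratio is `O(M^{1-p})`. -/
theorem HighDimRegime.tendsto_span_div (h : HighDimRegime N B) :
    Tendsto (fun M => (B M : ℝ) / N M) atTop (𝓝 0) := by
  obtain ⟨c, ⟨hc0, hc1⟩, hc⟩ := h.ratio
  obtain ⟨p, hp, C, hC, hN⟩ := h.eventually_inv_le
  have hlim : Tendsto (fun M : ℕ => c⁻¹ * 2 * C * (M : ℝ) ^ (-(p - 1))) atTop (𝓝 0) := by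
    have := ((tendsto_rpow_neg_atTop (by linarith : 0 < p - 1)).comp
      tendsto_natCast_atTop_atTop).const_mul (c⁻¹ * 2 * C)
    simpa using this
  refine squeeze_zero' (Eventually.of_forall fun M => by positivity) ?_ hlim
  filter_upwards [hc.eventually_const_lt (half_lt_self hc0), hN, eventually_ge_atTop 1] with
    M h2 h3 hM1
  have hMpos : (0 : ℝ) < M := by exact_mod_cast hM1
  have hB : (0 : ℝ) < B M := by
    rcases Nat.eq_zero_or_pos (B M) with h0 | h0
    · rw [h0] at h2; simp at h2; linarith
    · exact_mod_cast h0
  rw [lt_div_iff₀ hB] at h2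
  have h4 : (B M : ℝ) ≤ c⁻¹ * 2 * M := by
    rw [mul_assoc, ← div_eq_inv_mul, le_div_iff₀ hc0]; linarith
  calc (B M : ℝ) / N M = B M * (N M : ℝ)⁻¹ := div_eq_mul_inv _ _
    _ ≤ c⁻¹ * 2 * M * (C * (M : ℝ) ^ (-p)) := by
        gcongr; exact h3.2
    _ = c⁻¹ * 2 * C * ((M : ℝ) ^ (1 : ℝ) * (M : ℝ) ^ (-p)) := by rw [Real.rpow_one]; ring
    _ = _ := by rw [← Real.rpow_add hMpos]; congr 2; ring

theorem HighDimRegime.eventually_span_lt (h : HighDimRegime N B) :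
    ∀ᶠ M in atTop, 0 < N M ∧ B M < N M := by
  obtain ⟨p, hp, C, hC, hN⟩ := h.eventually_inv_le
  filter_upwards [hN, h.tendsto_span_div.eventually_lt_const one_pos] with M h1 h2
  have hNr : (0 : ℝ) < N M := by exact_mod_cast h1.1
  rw [div_lt_one hNr] at h2
  exact ⟨h1.1, by exact_mod_cast h2⟩

/-- The union bound over frequencies remains geometric: `log N ≤ (c/2) M`, while the tail
contributes at most `-c M` because `B > M`. -/
theorem HighDimRegime.eventually_mul_exp_le (h : HighDimRegime N B) {c : ℝ} (hc : 0 < c) :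
    ∀ᶠ M in atTop, (N M : ℝ) * Real.exp (-c * (B M + 1)) ≤ Real.exp (-(c / 2)) ^ M := by
  have hb := (h.log_isLittleO.def (half_pos hc))
  filter_upwards [hb, h.eventually_span_lt, h.eventually_lt_span] with M h1 h2 h3
  have hNr : (0 : ℝ) < N M := by exact_mod_cast h2.1
  have h3' : (M : ℝ) ≤ B M := by exact_mod_cast h3.le
  have h4 : Real.log (N M) ≤ c / 2 * M := by
    refine (le_abs_self _).trans (h1.trans_eq ?_)
    rw [Real.norm_of_nonneg (Nat.cast_nonneg _)]
  rw [← Real.exp_nat_mul]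
  calc (N M : ℝ) * Real.exp (-c * (B M + 1))
      = Real.exp (Real.log (N M) + -c * (B M + 1)) := by rw [Real.exp_add, Real.exp_log hNr]
    _ ≤ _ := by
      apply Real.exp_le_exp.2
      nlinarith

end Regime

/-! ### Orthogonality of the window frequencies and concentration of quadratic forms. -/

section Fourier

/-- A geometric sum over an `N`-th root of unity, which `|d| < N` keeps different from one when `d ≠
0`. -/
theorem sum_exp_eq_ite {N : ℕ} (hN : 0 < N) {d : ℤ} (hd : |d| < N) :
    ∑ n : Fin N, Complex.exp (-(2 * (Real.pi : ℂ) * Complex.I * (n : ℂ) * ((d : ℂ) / N))) =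
      if d = 0 then (N : ℂ) else 0 := by
  split_ifs with h0
  · simp [h0]
  · have hNc : (N : ℂ) ≠ 0 := by exact_mod_cast hN.ne'
    set z : ℂ := Complex.exp (-(2 * (Real.pi : ℂ) * Complex.I * ((d : ℂ) / N))) with hz
    have h1 : z ≠ 1 := by
      intro h
      rw [hz, Complex.exp_eq_one_iff] at h
      obtain ⟨m, hm⟩ := h
      have h2 : (d : ℂ) = ((-m * N : ℤ) : ℂ) := by
        have hpi := Complex.two_pi_I_ne_zero
        have : (2 * (Real.pi : ℂ) * Complex.I) * ((d : ℂ) / N + m) = 0 := by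
          linear_combination -hm
        have h3 := (mul_eq_zero.1 this).resolve_left hpi
        field_simp at h3
        push_cast
        linear_combination h3
      have h3 : d = -m * N := by exact_mod_cast h2
      rw [h3, abs_mul, abs_neg, Nat.abs_cast] at hd
      have : |m| < 1 := by
        by_contra hh
        push Not at hh
        nlinarith
      rw [Int.abs_lt_one_iff] at this
      exact h0 (by rw [h3, this]; simp)
    have h2 : z ^ N = 1 := by
      rw [hz, ← Complex.exp_nat_mul, Complex.exp_eq_one_iff]
      refine ⟨-d, ?_⟩
      push_cast; field_simp
    have h3 : ∀ n : Fin N, Complex.exp (-(2 * (Real.pi : ℂ) * Complex.I * (n : ℂ) * ((d : ℂ) / N)))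
        = z ^ (n : ℕ) := by
      intro n
      rw [hz, ← Complex.exp_nat_mul]; congr 1; ring
    simp_rw [h3]
    rw [Fin.sum_univ_eq_sum_range (fun n => z ^ n), geom_sum_eq h1, h2]
    simp

/-- The quadratic form `v ↦ v^* Ŝ_x(ν) v` of the smoothed periodogram. -/
noncomputable def periodogramForm {d : ℕ} (N B : ℕ) (x : ℤ → Fin d → ℂ) (v : Fin d → ℂ) (ν : ℝ) :
    ℝ :=
  ((B : ℝ) + 1)⁻¹ * ∑ b ∈ Finset.Icc (-((B : ℤ) / 2)) ((B : ℤ) / 2),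
    ‖star v ⬝ᵥ finiteFourier N x (ν + (b : ℝ) / (N : ℝ))‖ ^ 2

theorem dotProduct_finiteFourier {d : ℕ} (N : ℕ) (x : ℤ → Fin d → ℂ) (v : Fin d → ℂ) (ν : ℝ) :
    star v ⬝ᵥ finiteFourier N x ν =
      ∑ p : Fin N × Fin d, (1 / (Real.sqrt (N : ℝ) : ℂ) *
        Complex.exp (-(2 * (Real.pi : ℂ) * Complex.I * (p.1 : ℂ) * (ν : ℂ))) * star (v p.2)) *
          x (p.1 : ℕ) p.2 := by
  rw [Fintype.sum_prod_type, Finset.sum_comm]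
  simp only [dotProduct, finiteFourier, Pi.smul_apply, Finset.sum_apply, smul_eq_mul, Pi.star_apply]
  refine Finset.sum_congr rfl fun i _ => ?_
  rw [Fin.sum_univ_eq_sum_range (fun n : ℕ => (1 / (Real.sqrt (N : ℝ) : ℂ) *
        Complex.exp (-(2 * (Real.pi : ℂ) * Complex.I * (n : ℂ) * (ν : ℂ))) * star (v i)) *
          x n i), Finset.mul_sum, Finset.mul_sum]
  exact Finset.sum_congr rfl fun n _ => by ring

theorem card_Icc_span {B : ℕ} (hB : Even B) :
    (Finset.Icc (-((B : ℤ) / 2)) ((B : ℤ) / 2)).card = B + 1 := by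
  obtain ⟨m, rfl⟩ := hB
  rw [Int.card_Icc]; omega

variable {Ω : Type*} [MeasurableSpace Ω] {μ : Measure Ω} {K : ℕ} {ε : ℤ → Ω → Fin K → ℂ}

/-- The Fourier coefficients over the window are orthogonal with common squared norm `‖v‖²`, for
every real `ν`: the centre cancels in the phase differences and `|b - b'| ≤ B < N`. -/
theorem IsComplexGaussianWhiteNoise.measureReal_periodogramForm_le
    (hε : IsComplexGaussianWhiteNoise ε μ) {N B : ℕ} (hN : 0 < N) (hB : Even B) (hBN : B < N)
    {v : Fin K → ℂ} (hv : 0 < ∑ i, ‖v i‖ ^ 2) (ν : ℝ) {δ : ℝ} (hδ : 0 ≤ δ) (hδ1 : δ ≤ 1) :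
    μ.real {ω | δ * ∑ i, ‖v i‖ ^ 2 ≤
      |periodogramForm N B (fun n => ε n ω) v ν - ∑ i, ‖v i‖ ^ 2|} ≤
      2 * Real.exp (-(δ ^ 2 / 8) * (B + 1)) := by
  set S := Finset.Icc (-((B : ℤ) / 2)) ((B : ℤ) / 2) with hS
  set σ := ∑ i, ‖v i‖ ^ 2 with hσ
  let A : S → Fin N × Fin K → ℂ := fun b p => 1 / (Real.sqrt (N : ℝ) : ℂ) *
    Complex.exp (-(2 * (Real.pi : ℂ) * Complex.I * (p.1 : ℂ) *
      ((ν + ((b : ℤ) : ℝ) / (N : ℝ) : ℝ) : ℂ))) * star (v p.2)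
  have hNr : (0 : ℝ) < N := by exact_mod_cast hN
  have hA : ∀ b b', ∑ s, A b s * star (A b' s) = if b = b' then (σ : ℂ) else 0 := by
    intro b b'
    have hd : |(b : ℤ) - b'| < N := by
      have h1 := Finset.mem_Icc.1 b.2
      have h2 := Finset.mem_Icc.1 b'.2
      rw [abs_lt]; omega
    have h1 : ∀ s : Fin N × Fin K, A b s * star (A b' s) =
        (1 / (N : ℂ)) * (Complex.exp (-(2 * (Real.pi : ℂ) * Complex.I * (s.1 : ℂ) *
          (((b - b' : ℤ) : ℂ) / N))) * ((‖v s.2‖ ^ 2 : ℝ) : ℂ)) := by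
      intro s
      have hsq : (1 / (Real.sqrt (N : ℝ) : ℂ)) * (1 / (Real.sqrt (N : ℝ) : ℂ)) = 1 / (N : ℂ) := by
        rw [div_mul_div_comm, ← Complex.ofReal_mul, Real.mul_self_sqrt hNr.le]; simp
      have hexp : Complex.exp (-(2 * (Real.pi : ℂ) * Complex.I * (s.1 : ℂ) *
          (((b - b' : ℤ) : ℂ) / N))) = Complex.exp (-(2 * (Real.pi : ℂ) * Complex.I * (s.1 : ℂ) *
            ((ν + ((b : ℤ) : ℝ) / (N : ℝ) : ℝ) : ℂ))) * star (Complex.exp (-(2 * (Real.pi : ℂ) *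
            Complex.I * (s.1 : ℂ) * ((ν + ((b' : ℤ) : ℝ) / (N : ℝ) : ℝ) : ℂ)))) := by
        rw [Complex.star_def, ← Complex.exp_conj, ← Complex.exp_add]
        congr 1
        simp only [map_neg, map_mul, Complex.conj_I, Complex.conj_ofReal, map_ofNat, map_natCast]
        push_cast
        ring
      have hvv : ((‖v s.2‖ ^ 2 : ℝ) : ℂ) = star (v s.2) * v s.2 := by
        rw [Complex.star_def, ← Complex.normSq_eq_conj_mul_self, Complex.normSq_eq_norm_sq]
      rw [hexp, hvv, ← hsq]
      simp only [A, star_mul', star_star]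
      have : star (1 / (Real.sqrt (N : ℝ) : ℂ)) = 1 / (Real.sqrt (N : ℝ) : ℂ) := by simp
      rw [this]
      ring
    simp_rw [h1]
    rw [← Finset.mul_sum, Fintype.sum_prod_type]
    simp_rw [← Finset.mul_sum]
    rw [← Finset.sum_mul, sum_exp_eq_ite hN hd, ← Complex.ofReal_sum, ← hσ]
    have : (b : ℤ) - b' = 0 ↔ b = b' := by rw [sub_eq_zero, Subtype.coe_inj]
    have hNc : (N : ℂ) ≠ 0 := by exact_mod_cast hN.ne'
    simp only [this]
    split_ifs
    · field_simp
    · simp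
  let f : Fin N × Fin K → ℤ × Fin K := fun p => (((p.1 : ℕ) : ℤ), p.2)
  have hf : Function.Injective f := by
    rintro ⟨a, b⟩ ⟨a', b'⟩ h
    simp only [f, Prod.mk.injEq, Nat.cast_inj] at h
    exact Prod.ext (Fin.ext h.1) h.2
  have hmain := measureReal_abs_sum_norm_sq_sub_ge_le
    (X := fun (p : Fin N × Fin K) ω => ε (p.1 : ℕ) ω p.2)
    (fun p => hε.law _ _) (hε.indep.precomp hf) A hv hA hδ hδ1
  have hcard : (Fintype.card S : ℝ) = B + 1 := by
    rw [Fintype.card_coe, card_Icc_span hB]; simp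
  rw [hcard] at hmain
  refine le_trans (le_of_eq ?_) hmain
  congr 1
  ext ω
  simp only [Set.mem_ofPred_eq]
  have hB1 : (0 : ℝ) < B + 1 := by positivity
  have e : ∑ b : S, ‖∑ s, A b s * ε (s.1 : ℕ) ω s.2‖ ^ 2 - σ * (B + 1) =
      (B + 1) * (periodogramForm N B (fun n => ε n ω) v ν - σ) := by
    unfold periodogramForm
    rw [mul_sub, ← mul_assoc, mul_inv_cancel₀ hB1.ne', one_mul, mul_comm σ, ← hS]
    congr 1
    rw [← Finset.sum_coe_sort S (fun b : ℤ =>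
      ‖star v ⬝ᵥ finiteFourier N (fun n => ε n ω) (ν + (b : ℝ) / (N : ℝ))‖ ^ 2)]
    refine Finset.sum_congr rfl fun b _ => ?_
    rw [dotProduct_finiteFourier]
  rw [e, abs_mul, abs_of_pos hB1, mul_comm (δ * σ)]
  exact (mul_le_mul_iff_right₀ hB1).symm

end Fourier

/-! ### Uniform almost sure convergence of the noise periodogram. -/

section UniformConvergence

variable {Ω : Type*} [MeasurableSpace Ω] {μ : Measure Ω} {K : ℕ}
  {ε : ℕ → ℤ → Ω → Fin K → ℂ} {N B : ℕ → ℕ}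

/-- Union bound over the `N` frequencies, then the first Borel–Cantelli lemma, which needs no
information on the joint law across `M`. -/
theorem ae_eventually_periodogramForm_lt [IsProbabilityMeasure μ] (h : HighDimRegime N B)
    (hε : ∀ M : ℕ, 1 ≤ M → IsComplexGaussianWhiteNoise (ε M) μ)
    {v : Fin K → ℂ} (hv : 0 < ∑ i, ‖v i‖ ^ 2) {δ : ℝ} (hδ : 0 < δ) (hδ1 : δ ≤ 1) :
    ∀ᵐ ω ∂μ, ∀ᶠ M in atTop, ∀ k : Fin (N M),
      |periodogramForm (N M) (B M) (fun n => ε M n ω) v ((k : ℝ) / (N M : ℝ)) - ∑ i, ‖v i‖ ^ 2| <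
        δ * ∑ i, ‖v i‖ ^ 2 := by
  have hc : 0 < δ ^ 2 / 8 := by positivity
  obtain ⟨M₀, hM₀⟩ := eventually_atTop.1 ((h.eventually_mul_exp_le hc).and
    (h.eventually_span_lt.and (eventually_ge_atTop 1)))
  let S : ℕ → Set Ω := fun M => ⋃ k : Fin (N M), {ω | δ * ∑ i, ‖v i‖ ^ 2 ≤
      |periodogramForm (N M) (B M) (fun n => ε M n ω) v ((k : ℝ) / (N M : ℝ)) - ∑ i, ‖v i‖ ^ 2|}
  -- The bad events are emptied below `M₀` so that the geometric bound holds for every `M`.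
  let T : ℕ → Set Ω := fun M => if M₀ ≤ M then S M else ∅
  have hT : ∀ M, μ (T M) ≤ ENNReal.ofReal (2 * Real.exp (-(δ ^ 2 / 8 / 2)) ^ M) := by
    intro M
    by_cases hM : M₀ ≤ M
    · simp only [T, if_pos hM]
      obtain ⟨h1, h2, h3⟩ := hM₀ M hM
      rw [← ofReal_measureReal]
      apply ENNReal.ofReal_le_ofReal
      refine (measureReal_iUnion_fintype_le _).trans ?_
      refine (Finset.sum_le_sum fun k _ =>
        (hε M h3).measureReal_periodogramForm_le h2.1 (h.even_span M h3) h2.2 hv _ hδ.le hδ1).trans ?_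
      rw [Finset.sum_const, Finset.card_univ, Fintype.card_fin, nsmul_eq_mul]
      linarith
    · simp [T, if_neg hM]
  have hsum : ∑' M, μ (T M) ≠ ⊤ := by
    refine ne_top_of_le_ne_top ?_ (ENNReal.tsum_le_tsum hT)
    have : Summable fun M : ℕ => 2 * Real.exp (-(δ ^ 2 / 8 / 2)) ^ M :=
      (summable_geometric_of_lt_one (Real.exp_pos _).le
        (Real.exp_lt_one_iff.2 (by linarith))).mul_left 2
    rw [← ENNReal.ofReal_tsum_of_nonneg (fun M => by positivity) this]
    exact ENNReal.ofReal_ne_top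
  filter_upwards [ae_eventually_notMem hsum] with ω hω
  filter_upwards [hω, eventually_ge_atTop M₀] with M h1 h2 k
  simp only [T, if_pos h2, S, Set.mem_iUnion, not_exists, Set.mem_ofPred_eq, not_le] at h1
  exact h1 k

theorem ae_tendsto_iSup_periodogramForm [IsProbabilityMeasure μ] (h : HighDimRegime N B)
    (hε : ∀ M : ℕ, 1 ≤ M → IsComplexGaussianWhiteNoise (ε M) μ) (v : Fin K → ℂ) :
    ∀ᵐ ω ∂μ, Tendsto (fun M => ⨆ k : Fin (N M),
      |periodogramForm (N M) (B M) (fun n => ε M n ω) v ((k : ℝ) / (N M : ℝ)) - ∑ i, ‖v i‖ ^ 2|)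
        atTop (𝓝 0) := by
  rcases (Finset.sum_nonneg fun i _ => sq_nonneg ‖v i‖ :
    0 ≤ ∑ i, ‖v i‖ ^ 2).eq_or_lt with h0 | hv
  · have hv : v = 0 := by
      ext i
      have := (Finset.sum_eq_zero_iff_of_nonneg fun i _ => sq_nonneg ‖v i‖).1 h0.symm i
        (Finset.mem_univ i)
      simpa using this
    refine Eventually.of_forall fun ω => ?_
    simp [hv, periodogramForm]
  -- Countably many tolerances `1 / (n + 1)` suffice, and keep the exceptional set null.
  · have := ae_all_iff.2 fun n : ℕ => ae_eventually_periodogramForm_lt h hε hv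
      (δ := 1 / ((n : ℝ) + 1)) (by positivity) (by
        rw [div_le_one (by positivity)]; linarith [(Nat.cast_nonneg n : (0 : ℝ) ≤ n)])
    filter_upwards [this] with ω hω
    rw [Metric.tendsto_atTop']
    intro η hη
    obtain ⟨n, hn⟩ := exists_nat_one_div_lt (div_pos hη hv)
    rw [lt_div_iff₀ hv] at hn
    obtain ⟨M₀, hM₀⟩ := eventually_atTop.1 (hω n)
    refine ⟨M₀, fun M hM => ?_⟩
    rw [Real.dist_0_eq_abs, abs_of_nonneg (Real.iSup_nonneg fun k => abs_nonneg _)]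
    refine (Real.iSup_le (fun k => (hM₀ M hM.le k).le) (by positivity)).trans_lt hn

/-- The test vector `e_i + c̄ e_j`. -/
noncomputable def polarVector (c : ℂ) (i j : Fin K) : Fin K → ℂ :=
  Pi.single i 1 + star c • Pi.single j 1

theorem star_polarVector_dotProduct (c : ℂ) (i j : Fin K) (z : Fin K → ℂ) :
    star (polarVector c i j) ⬝ᵥ z = z i + c * z j := by
  simp [polarVector, add_dotProduct, smul_dotProduct]

theorem mul_conj_eq_polarization (z w : ℂ) : z * star w = 1 / 4 *
    (((‖z + 1 * w‖ ^ 2 : ℝ) - (‖z + (-1) * w‖ ^ 2 : ℝ)) +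
      Complex.I * ((‖z + Complex.I * w‖ ^ 2 : ℝ) - (‖z + -Complex.I * w‖ ^ 2 : ℝ))) := by
  simp_rw [← Complex.normSq_eq_norm_sq, Complex.normSq_eq_conj_mul_self, Complex.star_def]
  simp only [map_add, map_mul, map_neg, map_one, Complex.conj_I]
  linear_combination (-1 / 2 * starRingEnd ℂ z * w + 1 / 2 * z * starRingEnd ℂ w) * Complex.I_sq

/-- Writes the limiting quadratic form in a shape to which the polarization identity applies, so
that the identity matrix is polarized exactly like the periodogram. -/
theorem sum_norm_polarVector_sq (c : ℂ) (i j : Fin K) :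
    ∑ l, ‖polarVector c i j l‖ ^ 2 =
      ∑ l, ‖(Pi.single l 1 : Fin K → ℂ) i + c * (Pi.single l 1 : Fin K → ℂ) j‖ ^ 2 := by
  refine Finset.sum_congr rfl fun l _ => ?_
  have h := star_polarVector_dotProduct c i j (Pi.single l 1)
  rw [← h]
  simp

theorem sum_single_mul_star (i j : Fin K) :
    ∑ l, (Pi.single l 1 : Fin K → ℂ) i * star ((Pi.single l 1 : Fin K → ℂ) j) =
      (1 : Matrix (Fin K) (Fin K) ℂ) i j := by
  simp [Pi.single_apply, Matrix.one_apply]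

/-- Polarization has the same four weights, of modulus `1 / 4`, for both matrices; hence an entry of
the difference is that combination of four quadratic-form errors. -/
theorem norm_smoothedPeriodogram_sub_one_apply_le (N B : ℕ) (x : ℤ → Fin K → ℂ) (ν : ℝ)
    (i j : Fin K) : ‖(smoothedPeriodogram N B x ν - 1) i j‖ ≤
      ∑ c ∈ ({1, -1, Complex.I, -Complex.I} : Finset ℂ),
        |periodogramForm N B x (polarVector c i j) ν - ∑ l, ‖polarVector c i j l‖ ^ 2| := by
  set D : ℂ → ℝ := fun c =>
    periodogramForm N B x (polarVector c i j) ν - ∑ l, ‖polarVector c i j l‖ ^ 2 with hD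
  have key : (smoothedPeriodogram N B x ν - 1) i j =
      1 / 4 * ((D 1 - D (-1)) + Complex.I * (D Complex.I - D (-Complex.I))) := by
    rw [Matrix.sub_apply, ← sum_single_mul_star]
    simp only [smoothedPeriodogram, Matrix.smul_apply, Matrix.sum_apply, Matrix.vecMulVec_apply,
      Pi.star_apply, smul_eq_mul]
    simp_rw [mul_conj_eq_polarization]
    simp only [hD, periodogramForm, star_polarVector_dotProduct, sum_norm_polarVector_sq]
    push_cast
    simp only [← Finset.mul_sum, Finset.sum_add_distrib, Finset.sum_sub_distrib]
    ring
  have hne : (1 : ℂ) ≠ -1 ∧ (1 : ℂ) ≠ Complex.I ∧ (1 : ℂ) ≠ -Complex.I ∧ (-1 : ℂ) ≠ Complex.I ∧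
      (-1 : ℂ) ≠ -Complex.I ∧ Complex.I ≠ -Complex.I := by
    refine ⟨?_, ?_, ?_, ?_, ?_, ?_⟩ <;> norm_num [Complex.ext_iff]
  obtain ⟨h1, h2, h3, h4, h5, h6⟩ := hne
  rw [Finset.sum_insert (by simp [h1, h2, h3]), Finset.sum_insert (by
    simp only [Finset.mem_insert, Finset.mem_singleton, not_or]; exact ⟨h4, h5⟩),
    Finset.sum_insert (by simpa using h6), Finset.sum_singleton]
  change _ ≤ |D 1| + (|D (-1)| + (|D Complex.I| + |D (-Complex.I)|))
  rw [key, norm_mul]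
  have e1 : ‖((D 1 : ℂ) - D (-1))‖ ≤ |D 1| + |D (-1)| :=
    (norm_sub_le _ _).trans (by simp)
  have e2 : ‖Complex.I * ((D Complex.I : ℂ) - D (-Complex.I))‖ ≤
      |D Complex.I| + |D (-Complex.I)| := by
    rw [norm_mul, Complex.norm_I, one_mul]
    exact (norm_sub_le _ _).trans (by simp)
  have e3 := norm_add_le ((D 1 : ℂ) - D (-1)) (Complex.I * ((D Complex.I : ℂ) - D (-Complex.I)))
  have e4 : ‖(1 / 4 : ℂ)‖ = 1 / 4 := by norm_num
  rw [e4]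
  have := abs_nonneg (D 1); have := abs_nonneg (D (-1))
  have := abs_nonneg (D Complex.I); have := abs_nonneg (D (-Complex.I))
  linarith

/-- The smoothed periodogram of a white noise of fixed dimension converges to the identity,
uniformly over the Fourier frequencies. -/
theorem ae_exists_tendsto_smoothedPeriodogram_sub_one [IsProbabilityMeasure μ]
    (h : HighDimRegime N B)
    (hε : ∀ M : ℕ, 1 ≤ M → IsComplexGaussianWhiteNoise (ε M) μ) :
    ∀ᵐ ω ∂μ, ∃ e : ℕ → ℝ, Tendsto e atTop (𝓝 0) ∧ ∀ M, ∀ k : Fin (N M),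
      ∑ i, ∑ j, ‖(smoothedPeriodogram (N M) (B M) (fun n => ε M n ω)
        ((k : ℝ) / (N M : ℝ)) - 1) i j‖ ≤ e M := by
  have h1 : ∀ᵐ ω ∂μ, ∀ i j : Fin K, ∀ c ∈ ({1, -1, Complex.I, -Complex.I} : Finset ℂ),
      Tendsto (fun M => ⨆ k : Fin (N M),
      |periodogramForm (N M) (B M) (fun n => ε M n ω) (polarVector c i j) ((k : ℝ) / (N M : ℝ)) -
        ∑ l, ‖polarVector c i j l‖ ^ 2|) atTop (𝓝 0) := by
    refine ae_all_iff.2 fun i => ae_all_iff.2 fun j => ?_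
    exact (ae_ball_iff (Finset.countable_toSet _)).2 fun c _ =>
      ae_tendsto_iSup_periodogramForm h hε _
  filter_upwards [h1] with ω hω
  refine ⟨fun M => ∑ i, ∑ j, ∑ c ∈ ({1, -1, Complex.I, -Complex.I} : Finset ℂ),
    ⨆ k : Fin (N M), |periodogramForm (N M) (B M) (fun n => ε M n ω) (polarVector c i j)
      ((k : ℝ) / (N M : ℝ)) - ∑ l, ‖polarVector c i j l‖ ^ 2|, ?_, ?_⟩
  · have := tendsto_finsetSum (Finset.univ : Finset (Fin K)) fun i _ =>
      tendsto_finsetSum (Finset.univ : Finset (Fin K)) fun j _ =>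
        tendsto_finsetSum ({1, -1, Complex.I, -Complex.I} : Finset ℂ) fun c hc => hω i j c hc
    simpa using this
  · intro M k
    refine Finset.sum_le_sum fun i _ => Finset.sum_le_sum fun j _ =>
      (norm_smoothedPeriodogram_sub_one_apply_le _ _ _ _ i j).trans
        (Finset.sum_le_sum fun c _ => ?_)
    exact le_ciSup (f := fun k : Fin (N M) =>
      |periodogramForm (N M) (B M) (fun n => ε M n ω) (polarVector c i j)
        ((k : ℝ) / (N M : ℝ)) - ∑ l, ‖polarVector c i j l‖ ^ 2|) (Set.finite_range _).bddAbove k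

end UniformConvergence

/-! ### Deterministic estimates for the filter. -/

section Deterministic

theorem norm_toLp_mulVec_le {m n : ℕ} (A : Matrix (Fin m) (Fin n) ℂ) (x : Fin n → ℂ) :
    ‖WithLp.toLp 2 (A *ᵥ x)‖ ≤ ‖A‖ * ‖WithLp.toLp 2 x‖ :=
  A.l2_opNorm_mulVec (WithLp.toLp 2 x)

theorem norm_toLp_le_sum {n : ℕ} (x : Fin n → ℂ) : ‖WithLp.toLp 2 x‖ ≤ ∑ i, ‖x i‖ := by
  have : WithLp.toLp 2 x = ∑ i, EuclideanSpace.single i (x i) := by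
    ext j
    simp [Pi.single_apply]
  rw [this]
  exact (norm_sum_le _ _).trans (by simp)

/-- The indices that belong to exactly one of `[0, N)` and `[-k, N - k)`. -/
noncomputable def shiftBoundary (N : ℕ) (k : ℤ) : Finset ℤ :=
  symmDiff (Finset.Ico (-k) (N - k)) (Finset.Ico 0 (N : ℤ))

theorem card_shiftBoundary_le (N : ℕ) (k : ℤ) : ((shiftBoundary N k).card : ℝ) ≤ 2 * |(k : ℝ)| := by
  have h : (shiftBoundary N k).card ≤ 2 * k.natAbs := by
    have hsub : shiftBoundary N k ⊆
        (Finset.Ico (-k) 0 ∪ Finset.Ico (N - k) (N : ℤ)) ∪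
          (Finset.Ico 0 (-k) ∪ Finset.Ico (N : ℤ) (N - k)) := by
      intro m hm
      simp only [shiftBoundary, Finset.mem_symmDiff, Finset.mem_Ico, Finset.mem_union] at hm ⊢
      omega
    refine (Finset.card_le_card hsub).trans ((Finset.card_union_le _ _).trans
      ((add_le_add (Finset.card_union_le _ _) (Finset.card_union_le _ _)).trans ?_))
    simp only [Int.card_Ico]
    omega
  calc ((shiftBoundary N k).card : ℝ) ≤ ((2 * k.natAbs : ℕ) : ℝ) := by exact_mod_cast h
    _ = 2 * |(k : ℝ)| := by rw [Nat.cast_mul, Nat.cast_natAbs]; simp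

theorem norm_sum_sub_sum_le_symmDiff {ι E : Type*} [DecidableEq ι] [SeminormedAddCommGroup E]
    (s t : Finset ι) (f : ι → E) :
    ‖∑ i ∈ s, f i - ∑ i ∈ t, f i‖ ≤ ∑ i ∈ symmDiff s t, ‖f i‖ := by
  rw [← Finset.sum_sdiff_sub_sum_sdiff]
  refine (norm_sub_le _ _).trans ((add_le_add (norm_sum_le _ _) (norm_sum_le _ _)).trans_eq ?_)
  rw [symmDiff_def, Finset.sup_eq_union, Finset.sum_union]
  exact disjoint_sdiff_sdiff

theorem norm_sum_range_shift_sub_le {E : Type*} [SeminormedAddCommGroup E] (N : ℕ) (k : ℤ)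
    (f : ℤ → E) : ‖∑ n ∈ Finset.range N, f ((n : ℤ) - k) - ∑ n ∈ Finset.range N, f n‖ ≤
      ∑ m ∈ shiftBoundary N k, ‖f m‖ := by
  have h2 : ∑ n ∈ Finset.range N, f n = ∑ m ∈ Finset.Ico 0 (N : ℤ), f m := by
    refine Finset.sum_bij (fun n _ => (n : ℤ)) ?_ ?_ ?_ ?_
    · intro n hn; simpa using hn
    · intro a _ b _ h; exact_mod_cast h
    · intro m hm
      rw [Finset.mem_Ico] at hm
      exact ⟨m.toNat, by rw [Finset.mem_range]; omega, by omega⟩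
    · intros; rfl
  have h1 : ∑ n ∈ Finset.range N, f ((n : ℤ) - k) = ∑ m ∈ Finset.Ico (-k) (N - k), f m := by
    refine Finset.sum_bij (fun n _ => (n : ℤ) - k) ?_ ?_ ?_ ?_
    · intro n hn; simp at hn ⊢; omega
    · intro a _ b _ h; simpa using h
    · intro m hm
      rw [Finset.mem_Ico] at hm
      exact ⟨(m + k).toNat, by rw [Finset.mem_range]; omega, by omega⟩
    · intros; rfl
  rw [h1, h2]
  exact norm_sum_sub_sum_le_symmDiff _ _ _

variable {M K : ℕ} {H : ℤ → Matrix (Fin M) (Fin K) ℂ}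

theorem norm_exp_neg_two_pi_mul (a b : ℝ) :
    ‖Complex.exp (-(2 * (Real.pi : ℂ) * Complex.I * (a : ℂ) * (b : ℂ)))‖ = 1 := by
  rw [show -(2 * (Real.pi : ℂ) * Complex.I * (a : ℂ) * (b : ℂ)) =
    ((-(2 * Real.pi * a * b) : ℝ) : ℂ) * Complex.I by push_cast; ring]
  exact Complex.norm_exp_ofReal_mul_I _

theorem summable_norm_of_summable_memory (hH : Summable fun k : ℤ => (1 + |(k : ℝ)|) * ‖H k‖) :
    Summable fun k => ‖H k‖ :=
  hH.of_nonneg_of_le (fun k => norm_nonneg _) fun k =>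
    le_mul_of_one_le_left (norm_nonneg _) (by linarith [abs_nonneg (k : ℝ)])

theorem hasSum_transferFunction (hH : Summable fun k => ‖H k‖) (ν : ℝ) :
    HasSum (fun k : ℤ => Complex.exp (-(2 * (Real.pi : ℂ) * Complex.I * (ν : ℂ) * (k : ℂ))) • H k)
      (transferFunction H ν) := by
  refine Summable.hasSum (Summable.of_norm ?_)
  refine hH.congr fun k => ?_
  have := norm_exp_neg_two_pi_mul ν k
  rw [Complex.ofReal_intCast] at this
  rw [norm_smul, this, one_mul]

theorem norm_transferFunction_le (hH : Summable fun k : ℤ => (1 + |(k : ℝ)|) * ‖H k‖) (ν : ℝ) :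
    ‖transferFunction H ν‖ ≤ ∑' k : ℤ, (1 + |(k : ℝ)|) * ‖H k‖ := by
  refine (hasSum_transferFunction (summable_norm_of_summable_memory hH) ν).norm_le_of_bounded
    hH.hasSum fun k => ?_
  have := norm_exp_neg_two_pi_mul ν k
  rw [Complex.ofReal_intCast] at this
  rw [norm_smul, this]
  gcongr
  linarith [abs_nonneg (k : ℝ)]

/-- Termwise `|e^{ia} - e^{ib}| ≤ |a - b|` produces a factor `2π|k||ν - ν'|`, absorbed by the weight
`1 + |k|`. -/
theorem norm_transferFunction_sub_le (hH : Summable fun k : ℤ => (1 + |(k : ℝ)|) * ‖H k‖)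
    (ν ν' : ℝ) : ‖transferFunction H ν - transferFunction H ν'‖ ≤
      2 * Real.pi * |ν - ν'| * ∑' k : ℤ, (1 + |(k : ℝ)|) * ‖H k‖ := by
  have hs := summable_norm_of_summable_memory hH
  refine ((hasSum_transferFunction hs ν).sub (hasSum_transferFunction hs ν')).norm_le_of_bounded
    (hH.hasSum.mul_left _) fun k => ?_
  rw [← sub_smul, norm_smul, ← mul_assoc]
  gcongr
  have e : ∀ a : ℝ, -(2 * (Real.pi : ℂ) * Complex.I * (a : ℂ) * (k : ℂ)) =
    Complex.I * ((-(2 * Real.pi * a * k) : ℝ) : ℂ) := fun a => by push_cast; ring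
  rw [e, e]
  set a : ℝ := -(2 * Real.pi * ν * k)
  set b : ℝ := -(2 * Real.pi * ν' * k)
  have h1 : Complex.exp (Complex.I * (a : ℂ)) - Complex.exp (Complex.I * (b : ℂ)) =
      Complex.exp ((b : ℂ) * Complex.I) * (Complex.exp (Complex.I * ((a - b : ℝ) : ℂ)) - 1) := by
    rw [mul_sub, ← Complex.exp_add, mul_one]
    congr 2 <;> push_cast <;> ring
  rw [h1, norm_mul, Complex.norm_exp_ofReal_mul_I, one_mul]
  refine (Real.norm_exp_I_mul_ofReal_sub_one_le).trans ?_
  rw [Real.norm_eq_abs, show a - b = -(2 * Real.pi * (ν - ν') * k) by simp only [a, b]; ring,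
    abs_neg, abs_mul, abs_mul, abs_of_pos Real.two_pi_pos]
  gcongr
  linarith

/-- For each lag `k`, the transform of the delayed input is a phase times that of the input, except
at the indices in `shiftBoundary N k`. Since the phases have modulus one, the bound does not depend
on `ν`. -/
theorem norm_finiteFourier_sub_mulVec_le (hH : Summable fun k => ‖H k‖)
    {x : ℤ → Fin K → ℂ} {y : ℤ → Fin M → ℂ}
    (hy : ∀ n, HasSum (fun k : ℤ => H k *ᵥ x (n - k)) (y n)) (N : ℕ) (ν : ℝ) {c : ℝ}
    (hc : HasSum (fun k => ‖H k‖ * ∑ m ∈ shiftBoundary N k, ∑ i, ‖x m i‖) c) :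
    ‖WithLp.toLp 2 (finiteFourier N y ν - transferFunction H ν *ᵥ finiteFourier N x ν)‖ ≤
      (√(N : ℝ))⁻¹ * c := by
  set e : ℤ → ℂ := fun n => Complex.exp (-(2 * (Real.pi : ℂ) * Complex.I * (n : ℂ) * (ν : ℂ)))
    with he
  have hne : ∀ n, ‖e n‖ = 1 := fun n => by
    have := norm_exp_neg_two_pi_mul n ν
    rwa [Complex.ofReal_intCast] at this
  have h1 : HasSum (fun k : ℤ => (1 / (√(N : ℝ) : ℂ)) • ∑ n ∈ Finset.range N,
      e n • (H k *ᵥ x (n - k))) (finiteFourier N y ν) := by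
    unfold finiteFourier
    refine HasSum.const_smul _ (hasSum_sum fun n _ => ?_)
    have := (hy n).const_smul (e n)
    simpa [he] using this
  have h2 : HasSum (fun k : ℤ => (e k • H k) *ᵥ finiteFourier N x ν)
      (transferFunction H ν *ᵥ finiteFourier N x ν) := by
    have h := hasSum_transferFunction hH ν
    have hcont : Continuous fun A : Matrix (Fin M) (Fin K) ℂ => A *ᵥ finiteFourier N x ν :=
      continuous_id.matrix_mulVec continuous_const
    let φ : Matrix (Fin M) (Fin K) ℂ →+ (Fin M → ℂ) :=
      { toFun := fun A => A *ᵥ finiteFourier N x ν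
        map_zero' := Matrix.zero_mulVec _
        map_add' := fun A B => Matrix.add_mulVec A B _ }
    have h' := h.map φ hcont
    refine h'.congr_fun fun k => ?_
    simp only [φ, Function.comp_apply, AddMonoidHom.coe_mk, ZeroHom.coe_mk, he]
    congr 4
    ring
  have h3 := h1.sub h2
  have h4 := h3.map (WithLp.linearEquiv 2 ℂ (Fin M → ℂ)).symm
    (PiLp.continuous_toLp 2 (fun _ : Fin M => ℂ))
  refine h4.norm_le_of_bounded (hc.mul_left (√(N : ℝ))⁻¹) fun k => ?_
  -- The modulated input: a delay by `k` becomes a shift of the summation range of `f`, times `e k`.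
  set f : ℤ → EuclideanSpace ℂ (Fin K) := fun m => e m • WithLp.toLp 2 (x m) with hf
  have hterm : (1 / (√(N : ℝ) : ℂ)) • ∑ n ∈ Finset.range N, e n • (H k *ᵥ x (n - k)) -
      (e k • H k) *ᵥ finiteFourier N x ν =
      H k *ᵥ WithLp.ofLp ((1 / (√(N : ℝ) : ℂ) * e k) •
        (∑ n ∈ Finset.range N, f ((n : ℤ) - k) - ∑ n ∈ Finset.range N, f n)) := by
    have hadd : ∀ n : ℕ, e n = e k * e (n - k) := fun n => by
      simp only [he]
      rw [← Complex.exp_add]; congr 1; push_cast; ring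
    have hsum : ∀ g : ℕ → ℤ, H k *ᵥ (∑ n ∈ Finset.range N, WithLp.ofLp (f (g n))) =
        ∑ n ∈ Finset.range N, e (g n) • (H k *ᵥ x (g n)) := fun g => by
      rw [Matrix.mulVec_sum]
      exact Finset.sum_congr rfl fun n _ => by simp [hf, Matrix.mulVec_smul]
    simp only [WithLp.ofLp_smul, WithLp.ofLp_sub, WithLp.ofLp_sum, Matrix.mulVec_smul,
      Matrix.mulVec_sub, smul_sub]
    congr 1
    · rw [hsum, mul_smul, Finset.smul_sum (r := e k)]
      congr 1
      refine Finset.sum_congr rfl fun n _ => ?_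
      rw [smul_smul, ← hadd]
    · rw [hsum, Matrix.smul_mulVec]
      unfold finiteFourier
      rw [Matrix.mulVec_smul, Matrix.mulVec_sum, mul_comm (1 / (√(N : ℝ) : ℂ)) (e k),
        mul_smul]
      congr 2
      refine Finset.sum_congr rfl fun n _ => ?_
      rw [Matrix.mulVec_smul]
      simp [he]
  change ‖WithLp.toLp 2 ((1 / (√(N : ℝ) : ℂ)) • ∑ n ∈ Finset.range N, e n • (H k *ᵥ x (n - k)) -
      (e k • H k) *ᵥ finiteFourier N x ν)‖ ≤ _
  rw [hterm]
  refine (norm_toLp_mulVec_le _ _).trans ?_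
  rw [WithLp.toLp_ofLp, norm_smul, norm_mul, hne, mul_one]
  have hN : ‖(1 / (√(N : ℝ) : ℂ))‖ = (√(N : ℝ))⁻¹ := by
    rw [norm_div, norm_one, Complex.norm_real, Real.norm_of_nonneg (Real.sqrt_nonneg _), one_div]
  rw [hN, mul_left_comm]
  gcongr
  refine (norm_sum_range_shift_sub_le N k f).trans (Finset.sum_le_sum fun m _ => ?_)
  rw [hf, norm_smul, hne, one_mul]
  exact norm_toLp_le_sum _

end Deterministic

open scoped ENNReal

/-! ### Second moment of the boundary effect. -/

section Remainder

variable {Ω : Type*} [MeasurableSpace Ω] {μ : Measure Ω} {M K : ℕ}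
  {H : ℤ → Matrix (Fin M) (Fin K) ℂ} {ε : ℤ → Ω → Fin K → ℂ}

/-- The random variable controlling, up to a factor `N^{-1/2}`, the difference between the finite
Fourier transforms of the output and of the input of a filter. -/
noncomputable def boundaryEffect (H : ℤ → Matrix (Fin M) (Fin K) ℂ) (N : ℕ)
    (x : ℤ → Fin K → ℂ) : ℝ≥0∞ :=
  ∑' k : ℤ, ‖H k‖ₑ * ∑ m ∈ shiftBoundary N k, ∑ i, ‖x m i‖ₑ

theorem hasSum_boundaryEffect_toReal (N : ℕ) (x : ℤ → Fin K → ℂ)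
    (h : boundaryEffect H N x ≠ ⊤) :
    HasSum (fun k => ‖H k‖ * ∑ m ∈ shiftBoundary N k, ∑ i, ‖x m i‖)
      (boundaryEffect H N x).toReal := by
  have := (ENNReal.hasSum_toReal h)
  rw [boundaryEffect, ENNReal.tsum_toReal_eq (fun k => ENNReal.ne_top_of_tsum_ne_top h k)]
  convert! this using 2 with k
  rw [ENNReal.toReal_mul, toReal_enorm, ENNReal.toReal_sum (fun m _ =>
    ENNReal.sum_ne_top.2 fun i _ => enorm_ne_top)]
  congr 1
  refine Finset.sum_congr rfl fun m _ => ?_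
  rw [ENNReal.toReal_sum (fun i _ => enorm_ne_top)]
  simp

theorem IsComplexGaussianWhiteNoise.aemeasurable (hε : IsComplexGaussianWhiteNoise ε μ) (n : ℤ)
    (i : Fin K) : AEMeasurable (fun ω => ε n ω i) μ :=
  (hε.law n i).aemeasurable

theorem IsComplexGaussianWhiteNoise.aemeasurable_boundaryEffect
    (hε : IsComplexGaussianWhiteNoise ε μ) (N : ℕ) :
    AEMeasurable (fun ω => boundaryEffect H N (fun n => ε n ω)) μ := by
  refine AEMeasurable.tsum fun k => AEMeasurable.const_mul ?_ _
  exact Finset.aemeasurable_fun_sum _ fun m _ => Finset.aemeasurable_fun_sum _ fun i _ =>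
    (hε.aemeasurable m i).enorm

theorem lintegral_enorm_sq_stdComplexGaussian_ne_top :
    ∫⁻ z : ℂ, ‖z‖ₑ ^ 2 ∂stdComplexGaussian ≠ ⊤ := by
  have := memLp_two_stdComplexGaussian.2
  rw [eLpNorm_lt_top_iff_lintegral_rpow_enorm_lt_top (by simp) (by simp)] at this
  simpa using this.ne

/-- The crude inequality `ab ≤ a² + b²` covers equal and distinct indices alike, without
independence. -/
theorem IsComplexGaussianWhiteNoise.lintegral_enorm_mul_enorm_le
    (hε : IsComplexGaussianWhiteNoise ε μ) (n m : ℤ) (i j : Fin K) :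
    ∫⁻ ω, ‖ε n ω i‖ₑ * ‖ε m ω j‖ₑ ∂μ ≤ 2 * ∫⁻ z : ℂ, ‖z‖ₑ ^ 2 ∂stdComplexGaussian := by
  have h : ∀ n i, ∫⁻ ω, ‖ε n ω i‖ₑ ^ 2 ∂μ = ∫⁻ z : ℂ, ‖z‖ₑ ^ 2 ∂stdComplexGaussian :=
    fun n i => (hε.law n i).lintegral_comp (f := fun z => ‖z‖ₑ ^ 2) (by fun_prop)
  calc ∫⁻ ω, ‖ε n ω i‖ₑ * ‖ε m ω j‖ₑ ∂μ ≤ ∫⁻ ω, ‖ε n ω i‖ₑ ^ 2 + ‖ε m ω j‖ₑ ^ 2 ∂μ := by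
        refine lintegral_mono fun ω => ?_
        rcases le_total ‖ε n ω i‖ₑ ‖ε m ω j‖ₑ with hle | hle
        · exact le_add_left ((mul_le_mul_left hle _).trans_eq (pow_two _).symm)
        · exact le_add_right ((mul_le_mul_right hle _).trans_eq (pow_two _).symm)
    _ = _ := by
        rw [lintegral_add_left' ((hε.aemeasurable n i).enorm.pow_const 2), h, h, two_mul]

theorem IsComplexGaussianWhiteNoise.lintegral_sum_mul_sum_le
    (hε : IsComplexGaussianWhiteNoise ε μ) (s t : Finset ℤ) :
    ∫⁻ ω, (∑ m ∈ s, ∑ i, ‖ε m ω i‖ₑ) * (∑ m ∈ t, ∑ i, ‖ε m ω i‖ₑ) ∂μ ≤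
      s.card * t.card * (K ^ 2 * (2 * ∫⁻ z : ℂ, ‖z‖ₑ ^ 2 ∂stdComplexGaussian)) := by
  have hm : ∀ p q : ℤ × Fin K, AEMeasurable (fun ω => ‖ε p.1 ω p.2‖ₑ * ‖ε q.1 ω q.2‖ₑ) μ :=
    fun p q => (hε.aemeasurable _ _).enorm.mul (hε.aemeasurable _ _).enorm
  simp_rw [← Finset.sum_product', Finset.sum_mul_sum]
  rw [lintegral_finsetSum' _ fun p _ => Finset.aemeasurable_fun_sum _ fun q _ => hm p q]
  calc _ ≤ ∑ p ∈ s ×ˢ (Finset.univ : Finset (Fin K)), ∑ q ∈ t ×ˢ (Finset.univ : Finset (Fin K)),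
        2 * ∫⁻ z : ℂ, ‖z‖ₑ ^ 2 ∂stdComplexGaussian := by
        refine Finset.sum_le_sum fun p _ => ?_
        rw [lintegral_finsetSum' _ fun q _ => hm p q]
        exact Finset.sum_le_sum fun q _ => hε.lintegral_enorm_mul_enorm_le _ _ _ _
    _ = _ := by
        simp only [Finset.sum_const, Finset.card_product, Finset.card_univ, Fintype.card_fin,
          nsmul_eq_mul]
        push_cast
        ring

/-- The square is expanded as a double series, each term costing the product of two boundary
cardinalities. These are at most `2|k|`, so the bound is uniform in `N`. -/
theorem IsComplexGaussianWhiteNoise.lintegral_boundaryEffect_sq_le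
    (hε : IsComplexGaussianWhiteNoise ε μ) (hH : Summable fun k : ℤ => (1 + |(k : ℝ)|) * ‖H k‖)
    {C : ℝ} (hC : ∑' k : ℤ, (1 + |(k : ℝ)|) * ‖H k‖ ≤ C) (N : ℕ) :
    ∫⁻ ω, boundaryEffect H N (fun n => ε n ω) ^ 2 ∂μ ≤
      ENNReal.ofReal (2 * C) ^ 2 * (K ^ 2 * (2 * ∫⁻ z : ℂ, ‖z‖ₑ ^ 2 ∂stdComplexGaussian)) := by
  set V := (K : ℝ≥0∞) ^ 2 * (2 * ∫⁻ z : ℂ, ‖z‖ₑ ^ 2 ∂stdComplexGaussian) with hV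
  have hm : ∀ k, AEMeasurable (fun ω => ∑ m ∈ shiftBoundary N k, ∑ i, ‖ε m ω i‖ₑ) μ := fun k =>
    Finset.aemeasurable_fun_sum _ fun m _ => Finset.aemeasurable_fun_sum _ fun i _ =>
      (hε.aemeasurable m i).enorm
  have e : ∀ ω, boundaryEffect H N (fun n => ε n ω) ^ 2 = ∑' k, ∑' l, (‖H k‖ₑ * ‖H l‖ₑ) *
      ((∑ m ∈ shiftBoundary N k, ∑ i, ‖ε m ω i‖ₑ) * (∑ m ∈ shiftBoundary N l, ∑ i, ‖ε m ω i‖ₑ)) := by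
    intro ω
    rw [pow_two, boundaryEffect, ← ENNReal.tsum_mul_right]
    refine tsum_congr fun k => ?_
    rw [← ENNReal.tsum_mul_left]
    exact tsum_congr fun l => mul_mul_mul_comm _ _ _ _
  have hS : ∑' k, ‖H k‖ₑ * (shiftBoundary N k).card ≤ ENNReal.ofReal (2 * C) := by
    refine le_trans (ENNReal.tsum_le_tsum (g := fun k : ℤ =>
      ENNReal.ofReal (2 * ((1 + |(k : ℝ)|) * ‖H k‖))) fun k => ?_) ?_
    · rw [← ofReal_norm, ← ENNReal.ofReal_natCast, ← ENNReal.ofReal_mul (norm_nonneg _)]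
      apply ENNReal.ofReal_le_ofReal
      have := card_shiftBoundary_le N k
      nlinarith [norm_nonneg (H k)]
    · rw [← ENNReal.ofReal_tsum_of_nonneg (fun k => by positivity) (hH.mul_left 2), tsum_mul_left]
      exact ENNReal.ofReal_le_ofReal (by linarith)
  have hm2 : ∀ k l, AEMeasurable (fun ω => (∑ m ∈ shiftBoundary N k, ∑ i, ‖ε m ω i‖ₑ) *
      (∑ m ∈ shiftBoundary N l, ∑ i, ‖ε m ω i‖ₑ)) μ := fun k l => (hm k).mul (hm l)
  simp_rw [e]
  rw [lintegral_tsum fun k => AEMeasurable.tsum fun l => (hm2 k l).const_mul _]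
  calc _ ≤ ∑' k, ∑' l, (‖H k‖ₑ * (shiftBoundary N k).card) *
        ((‖H l‖ₑ * (shiftBoundary N l).card) * V) := by
        refine ENNReal.tsum_le_tsum fun k => ?_
        rw [lintegral_tsum fun l => (hm2 k l).const_mul _]
        refine ENNReal.tsum_le_tsum fun l => ?_
        rw [lintegral_const_mul'' _ (hm2 k l)]
        refine (mul_le_mul_right (hε.lintegral_sum_mul_sum_le _ _) _).trans_eq ?_
        rw [← hV]; ring
    _ = (∑' k, ‖H k‖ₑ * (shiftBoundary N k).card) ^ 2 * V := by
        simp_rw [ENNReal.tsum_mul_left, ENNReal.tsum_mul_right]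
        ring
    _ ≤ _ := by gcongr

end Remainder

/-! ### Almost sure vanishing of the filtering remainder. -/

section RemainderLimit

variable {Ω : Type*} [MeasurableSpace Ω] {μ : Measure Ω} {K : ℕ} {N B : ℕ → ℕ}
  {H : (M : ℕ) → ℤ → Matrix (Fin M) (Fin K) ℂ} {ε : ℕ → ℤ → Ω → Fin K → ℂ}

/-- The expectations are `O(M^{-p})` with `p > 1`, so from `M₀` on the random series has finite
expectation; it converges almost surely and its terms tend to zero. -/
theorem ae_tendsto_boundaryEffect (h : HighDimRegime N B) (hH : FilterAssumption H)
    (hε : ∀ M : ℕ, 1 ≤ M → IsComplexGaussianWhiteNoise (ε M) μ) :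
    ∀ᵐ ω ∂μ, Tendsto (fun M => ENNReal.ofReal ((N M : ℝ)⁻¹) *
      boundaryEffect (H M) (N M) (fun n => ε M n ω) ^ 2) atTop (𝓝 0) := by
  obtain ⟨C, hC⟩ := hH.memory
  obtain ⟨p, hp, D, hD, hN⟩ := h.eventually_inv_le
  obtain ⟨M₀, hM₀⟩ := eventually_atTop.1 (hN.and (eventually_ge_atTop 1))
  set V := ENNReal.ofReal (2 * C) ^ 2 *
    (K ^ 2 * (2 * ∫⁻ z : ℂ, ‖z‖ₑ ^ 2 ∂stdComplexGaussian)) with hV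
  have hVtop : V ≠ ⊤ := by
    refine ENNReal.mul_ne_top (ENNReal.pow_ne_top ENNReal.ofReal_ne_top)
      (ENNReal.mul_ne_top (by simp) (ENNReal.mul_ne_top (by simp)
      lintegral_enorm_sq_stdComplexGaussian_ne_top))
  let F : ℕ → Ω → ℝ≥0∞ := fun M ω => if M₀ ≤ M then ENNReal.ofReal ((N M : ℝ)⁻¹) *
      boundaryEffect (H M) (N M) (fun n => ε M n ω) ^ 2 else 0
  have hF : ∀ M, AEMeasurable (F M) μ ∧
      ∫⁻ ω, F M ω ∂μ ≤ ENNReal.ofReal (D * (M : ℝ) ^ (-p)) * V := by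
    intro M
    by_cases hM : M₀ ≤ M
    · obtain ⟨h1, h2⟩ := hM₀ M hM
      have hm := ((hε M h2).aemeasurable_boundaryEffect (H := H M) (N M)).pow_const 2
      simp only [F, if_pos hM]
      refine ⟨hm.const_mul _, ?_⟩
      rw [lintegral_const_mul'' _ hm]
      exact mul_le_mul' (ENNReal.ofReal_le_ofReal h1.2)
        ((hε M h2).lintegral_boundaryEffect_sq_le (hC M h2).1 (hC M h2).2 _)
    · simp [F, if_neg hM]
  have hsum : ∫⁻ ω, ∑' M, F M ω ∂μ ≠ ⊤ := by
    rw [lintegral_tsum fun M => (hF M).1]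
    refine ne_top_of_le_ne_top ?_ (ENNReal.tsum_le_tsum fun M => (hF M).2)
    have hs : Summable fun M : ℕ => D * (M : ℝ) ^ (-p) :=
      (Real.summable_nat_rpow.2 (by linarith)).mul_left D
    rw [ENNReal.tsum_mul_right, ← ENNReal.ofReal_tsum_of_nonneg (fun M => by positivity) hs]
    exact ENNReal.mul_ne_top ENNReal.ofReal_ne_top hVtop
  filter_upwards [ae_lt_top' (AEMeasurable.tsum fun M => (hF M).1) hsum] with ω hω
  refine (ENNReal.tendsto_atTop_zero_of_tsum_ne_top hω.ne).congr' ?_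
  filter_upwards [eventually_ge_atTop M₀] with M hM
  simp only [F, if_pos hM]

/-- The finite Fourier transform of the output of a filter is, uniformly over the frequencies,
close to the transfer function applied to the finite Fourier transform of the input. -/
theorem ae_exists_tendsto_finiteFourier_sub (h : HighDimRegime N B) (hH : FilterAssumption H)
    (hε : ∀ M : ℕ, 1 ≤ M → IsComplexGaussianWhiteNoise (ε M) μ)
    {u : (M : ℕ) → ℤ → Ω → Fin M → ℂ}
    (hu : ∀ M : ℕ, 1 ≤ M → IsFilterOutput (H M) (ε M) (u M) μ) :
    ∀ᵐ ω ∂μ, ∃ r : ℕ → ℝ, Tendsto r atTop (𝓝 0) ∧ (∀ M, 0 ≤ r M) ∧ ∀ᶠ M in atTop, ∀ ν : ℝ,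
      ‖WithLp.toLp 2 (finiteFourier (N M) (fun n => u M n ω) ν -
        transferFunction (H M) ν *ᵥ finiteFourier (N M) (fun n => ε M n ω) ν)‖ ≤ r M := by
  obtain ⟨C, hC⟩ := hH.memory
  have hu' : ∀ᵐ ω ∂μ, ∀ M, 1 ≤ M → ∀ n : ℤ,
      HasSum (fun k : ℤ => H M k *ᵥ ε M (n - k) ω) (u M n ω) := by
    refine ae_all_iff.2 fun M => ?_
    by_cases hM : 1 ≤ M
    · filter_upwards [ae_all_iff.2 fun n => hu M hM n] with ω hω _ using hω
    · exact Eventually.of_forall fun ω h => absurd h hM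
  filter_upwards [ae_tendsto_boundaryEffect h hH hε, hu'] with ω h1 h2
  refine ⟨fun M => √((N M : ℝ)⁻¹ *
    (boundaryEffect (H M) (N M) (fun n => ε M n ω)).toReal ^ 2), ?_, fun M => Real.sqrt_nonneg _, ?_⟩
  · have h3 := (ENNReal.tendsto_toReal (ENNReal.zero_ne_top)).comp h1
    have h4 := (Real.continuous_sqrt.tendsto _).comp h3
    simp only [ENNReal.toReal_zero, Real.sqrt_zero] at h4
    refine h4.congr fun M => ?_
    simp only [Function.comp_apply, ENNReal.toReal_mul, ENNReal.toReal_pow]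
    rw [ENNReal.toReal_ofReal (by positivity)]
  · filter_upwards [h1.eventually_lt_const ENNReal.zero_lt_top, h.eventually_span_lt,
      eventually_ge_atTop 1] with M h3 h4 h5 ν
    have hNr : (0 : ℝ) < N M := by exact_mod_cast h4.1
    -- As `1 / N > 0`, an infinite boundary effect would make the whole product infinite.
    have hfin : boundaryEffect (H M) (N M) (fun n => ε M n ω) ≠ ⊤ := by
      intro htop
      rw [htop, ENNReal.top_pow (by norm_num), ENNReal.mul_top] at h3
      · exact lt_irrefl _ h3
      · simpa using h4.1.ne'
    refine (norm_finiteFourier_sub_mulVec_le (x := fun n => ε M n ω) (y := fun n => u M n ω)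
      (summable_norm_of_summable_memory (hC M h5).1)
      (h2 M h5) (N M) ν (hasSum_boundaryEffect_toReal _ _ hfin)).trans_eq ?_
    rw [Real.sqrt_mul (by positivity), Real.sqrt_sq ENNReal.toReal_nonneg, Real.sqrt_inv]

end RemainderLimit

/-! ### Perturbation of smoothed periodograms. -/

section Assembly

theorem norm_vecMulVec_star_le {m n : ℕ} (x : Fin m → ℂ) (y : Fin n → ℂ) :
    ‖Matrix.vecMulVec x (star y)‖ ≤ ‖WithLp.toLp 2 x‖ * ‖WithLp.toLp 2 y‖ := by
  rw [Matrix.l2_opNorm_def]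
  refine ContinuousLinearMap.opNorm_le_bound _ (by positivity) fun z => ?_
  change ‖WithLp.toLp 2 (Matrix.vecMulVec x (star y) *ᵥ WithLp.ofLp z)‖ ≤ _
  have h1 : Matrix.vecMulVec x (star y) *ᵥ WithLp.ofLp z =
      (inner ℂ (WithLp.toLp 2 y) z : ℂ) • x := by
    rw [Matrix.vecMulVec_mulVec, EuclideanSpace.inner_eq_star_dotProduct, dotProduct_comm]
    ext i; simp [mul_comm]
  rw [h1, WithLp.toLp_smul, norm_smul, mul_comm, mul_assoc]
  gcongr
  exact norm_inner_le_norm _ _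

theorem norm_le_sum_norm_apply {m n : ℕ} (A : Matrix (Fin m) (Fin n) ℂ) :
    ‖A‖ ≤ ∑ i, ∑ j, ‖A i j‖ := by
  have h : A = ∑ i, ∑ j, A i j • Matrix.vecMulVec (Pi.single i 1) (star (Pi.single j 1)) := by
    ext a b
    simp [Matrix.sum_apply, Matrix.vecMulVec_apply, Pi.single_apply]
  conv_lhs => rw [h]
  refine (norm_sum_le _ _).trans (Finset.sum_le_sum fun i _ => (norm_sum_le _ _).trans
    (Finset.sum_le_sum fun j _ => ?_))
  rw [norm_smul]
  refine mul_le_of_le_one_right (norm_nonneg _) ((norm_vecMulVec_star_le _ _).trans_eq ?_)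
  change ‖EuclideanSpace.single i (1 : ℂ)‖ * ‖EuclideanSpace.single j (1 : ℂ)‖ = 1
  simp

variable {M K : ℕ}

/-- With `d = w - A z`, the difference is `d (Az)^* + (Az) d^* + d d^*`. The bound is made affine in
`‖z‖²` so that averaging over the window involves only the mean energy of `z`. -/
theorem norm_vecMulVec_sub_le (A : Matrix (Fin M) (Fin K) ℂ) (z : Fin K → ℂ) (w : Fin M → ℂ)
    {C a r : ℝ} (hA : ‖A‖ ≤ C) (ha : 0 ≤ a) (hr : 0 ≤ r)
    (h : ‖WithLp.toLp 2 (w - A *ᵥ z)‖ ≤ a * ‖WithLp.toLp 2 z‖ + r) :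
    ‖Matrix.vecMulVec w (star w) - A * Matrix.vecMulVec z (star z) * Aᴴ‖ ≤
      2 * C * (a * ‖WithLp.toLp 2 z‖ ^ 2 + r * (1 + ‖WithLp.toLp 2 z‖ ^ 2)) +
        2 * a ^ 2 * ‖WithLp.toLp 2 z‖ ^ 2 + 2 * r ^ 2 := by
  set d := w - A *ᵥ z with hd
  set q := ‖WithLp.toLp 2 z‖ with hq
  have hw : w = A *ᵥ z + d := by rw [hd]; abel
  have e : Matrix.vecMulVec w (star w) - A * Matrix.vecMulVec z (star z) * Aᴴ =
      Matrix.vecMulVec d (star (A *ᵥ z)) + Matrix.vecMulVec (A *ᵥ z) (star d) +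
        Matrix.vecMulVec d (star d) := by
    rw [Matrix.mul_vecMulVec, Matrix.vecMulVec_mul, ← Matrix.star_mulVec, hw, star_add,
      Matrix.add_vecMulVec, Matrix.vecMulVec_add, Matrix.vecMulVec_add]
    abel
  have hAz : ‖WithLp.toLp 2 (A *ᵥ z)‖ ≤ C * q :=
    (norm_toLp_mulVec_le A z).trans (by gcongr)
  have hC : 0 ≤ C := (norm_nonneg _).trans hA
  have hq0 : 0 ≤ q := norm_nonneg _
  have b1 : ‖Matrix.vecMulVec d (star (A *ᵥ z))‖ ≤ (a * q + r) * (C * q) :=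
    (norm_vecMulVec_star_le _ _).trans (by gcongr)
  have b2 : ‖Matrix.vecMulVec (A *ᵥ z) (star d)‖ ≤ (C * q) * (a * q + r) :=
    (norm_vecMulVec_star_le _ _).trans (by gcongr)
  have b3 : ‖Matrix.vecMulVec d (star d)‖ ≤ (a * q + r) * (a * q + r) :=
    (norm_vecMulVec_star_le _ _).trans (by gcongr)
  rw [e]
  refine (norm_add₃_le).trans ((add_le_add (add_le_add b1 b2) b3).trans ?_)
  have h1 : r * q ≤ r * (1 + q ^ 2) := by
    gcongr; nlinarith [sq_nonneg (q - 1)]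
  have h2 := mul_le_mul_of_nonneg_left h1 hC
  -- The cross term of `(a q + r)²` is split by `2 a q r ≤ a² q² + r²`.
  nlinarith [sq_nonneg (a * q - r)]

/-- The mean energy over the window is the trace of the periodogram, hence at most `K + e` for the
noise. -/
theorem sum_norm_finiteFourier_sq (N B : ℕ) (x : ℤ → Fin K → ℂ) (ν : ℝ) :
    ((B : ℝ) + 1)⁻¹ * ∑ b ∈ Finset.Icc (-((B : ℤ) / 2)) ((B : ℤ) / 2),
      ‖WithLp.toLp 2 (finiteFourier N x (ν + (b : ℝ) / (N : ℝ)))‖ ^ 2 =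
      ∑ i, (smoothedPeriodogram N B x ν i i).re := by
  have h : ∑ i, smoothedPeriodogram N B x ν i i =
      ((((B : ℝ) + 1)⁻¹ * ∑ b ∈ Finset.Icc (-((B : ℤ) / 2)) ((B : ℤ) / 2),
      ‖WithLp.toLp 2 (finiteFourier N x (ν + (b : ℝ) / (N : ℝ)))‖ ^ 2 : ℝ) : ℂ) := by
    simp only [smoothedPeriodogram, Matrix.smul_apply, Matrix.sum_apply, Matrix.vecMulVec_apply,
      Pi.star_apply, smul_eq_mul]
    rw [← Finset.mul_sum, Finset.sum_comm]
    simp_rw [EuclideanSpace.norm_sq_eq]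
    push_cast
    rw [one_div]
    congr 1
    refine Finset.sum_congr rfl fun b _ => Finset.sum_congr rfl fun i _ => ?_
    rw [Complex.star_def, Complex.mul_conj, Complex.normSq_eq_norm_sq]
    push_cast; rfl
  rw [← Complex.re_sum, h, Complex.ofReal_re]

theorem sum_re_smoothedPeriodogram_le (N B : ℕ) (x : ℤ → Fin K → ℂ) (ν : ℝ) {e : ℝ}
    (he : ∑ i, ∑ j, ‖(smoothedPeriodogram N B x ν - 1) i j‖ ≤ e) :
    ∑ i, (smoothedPeriodogram N B x ν i i).re ≤ K + e := by
  calc ∑ i, (smoothedPeriodogram N B x ν i i).re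
      ≤ ∑ i, (1 + ∑ j, ‖(smoothedPeriodogram N B x ν - 1) i j‖) := by
        refine Finset.sum_le_sum fun i _ => ?_
        have h1 : (smoothedPeriodogram N B x ν i i).re =
            1 + ((smoothedPeriodogram N B x ν - 1) i i).re := by
          simp [Matrix.sub_apply]
        rw [h1]
        gcongr
        exact (Complex.re_le_norm _).trans (Finset.single_le_sum
          (f := fun j => ‖(smoothedPeriodogram N B x ν - 1) i j‖)
          (fun j _ => norm_nonneg _) (Finset.mem_univ i))
    _ ≤ _ := by
        rw [Finset.sum_add_distrib]
        simpa using he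

/-- One matrix `A` serves the whole window: `a` measures the variation of the transfer function, `r`
the boundary remainder, `e` the noise error. -/
theorem norm_smoothedPeriodogram_sub_le {N B : ℕ} (hB : Even B) (x : ℤ → Fin K → ℂ)
    (y : ℤ → Fin M → ℂ) (A : Matrix (Fin M) (Fin K) ℂ) (ν : ℝ) {C a r e : ℝ} (hA : ‖A‖ ≤ C)
    (ha : 0 ≤ a) (hr : 0 ≤ r)
    (hd : ∀ b ∈ Finset.Icc (-((B : ℤ) / 2)) ((B : ℤ) / 2),
      ‖WithLp.toLp 2 (finiteFourier N y (ν + (b : ℝ) / (N : ℝ)) -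
        A *ᵥ finiteFourier N x (ν + (b : ℝ) / (N : ℝ)))‖ ≤
        a * ‖WithLp.toLp 2 (finiteFourier N x (ν + (b : ℝ) / (N : ℝ)))‖ + r)
    (he : ∑ i, ∑ j, ‖(smoothedPeriodogram N B x ν - 1) i j‖ ≤ e) :
    ‖smoothedPeriodogram N B y ν - A * Aᴴ‖ ≤
      C ^ 2 * e + (2 * C * (a * (K + e) + r * (1 + (K + e))) + 2 * a ^ 2 * (K + e) + 2 * r ^ 2) := by
  have hC : 0 ≤ C := (norm_nonneg _).trans hA
  set S := Finset.Icc (-((B : ℤ) / 2)) ((B : ℤ) / 2) with hS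
  set Z : ℤ → Fin K → ℂ := fun b => finiteFourier N x (ν + (b : ℝ) / (N : ℝ)) with hZ
  set W : ℤ → Fin M → ℂ := fun b => finiteFourier N y (ν + (b : ℝ) / (N : ℝ)) with hW
  have hB1 : (0 : ℝ) < B + 1 := by positivity
  have hq : ((B : ℝ) + 1)⁻¹ * ∑ b ∈ S, ‖WithLp.toLp 2 (Z b)‖ ^ 2 ≤ K + e :=
    (sum_norm_finiteFourier_sq N B x ν).trans_le (sum_re_smoothedPeriodogram_le N B x ν he)
  have e1 : smoothedPeriodogram N B y ν - A * Aᴴ = A * (smoothedPeriodogram N B x ν - 1) * Aᴴ +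
      (1 / ((B : ℂ) + 1)) • ∑ b ∈ S, (Matrix.vecMulVec (W b) (star (W b)) -
        A * Matrix.vecMulVec (Z b) (star (Z b)) * Aᴴ) := by
    simp only [smoothedPeriodogram, ← hS, Finset.sum_sub_distrib, smul_sub, Matrix.mul_sub,
      Matrix.sub_mul, Matrix.mul_smul, Matrix.smul_mul, Matrix.mul_sum, Matrix.sum_mul,
      Matrix.mul_one, hZ, hW]
    abel
  rw [e1]
  refine (norm_add_le _ _).trans (add_le_add ?_ ?_)
  · have h1 : ‖smoothedPeriodogram N B x ν - 1‖ ≤ e := (norm_le_sum_norm_apply _).trans he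
    calc ‖A * (smoothedPeriodogram N B x ν - 1) * Aᴴ‖
        ≤ ‖A‖ * ‖smoothedPeriodogram N B x ν - 1‖ * ‖Aᴴ‖ :=
          (Matrix.l2_opNorm_mul _ _).trans (by gcongr; exact Matrix.l2_opNorm_mul _ _)
      _ ≤ C * e * C := by
          rw [Matrix.l2_opNorm_conjTranspose]
          gcongr
          exact mul_nonneg hC ((norm_nonneg _).trans h1)
      _ = C ^ 2 * e := by ring
  · have hn : ‖(1 / ((B : ℂ) + 1))‖ = ((B : ℝ) + 1)⁻¹ := by
      rw [show (1 / ((B : ℂ) + 1)) = ((((B : ℝ) + 1)⁻¹ : ℝ) : ℂ) by push_cast; rw [one_div],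
        Complex.norm_real, Real.norm_of_nonneg (by positivity)]
    rw [norm_smul, hn]
    set Q := ((B : ℝ) + 1)⁻¹ * ∑ b ∈ S, ‖WithLp.toLp 2 (Z b)‖ ^ 2 with hQ
    calc ((B : ℝ) + 1)⁻¹ * ‖∑ b ∈ S, (Matrix.vecMulVec (W b) (star (W b)) -
        A * Matrix.vecMulVec (Z b) (star (Z b)) * Aᴴ)‖
        ≤ ((B : ℝ) + 1)⁻¹ * ∑ b ∈ S, (2 * C * (a * ‖WithLp.toLp 2 (Z b)‖ ^ 2 +
          r * (1 + ‖WithLp.toLp 2 (Z b)‖ ^ 2)) + 2 * a ^ 2 * ‖WithLp.toLp 2 (Z b)‖ ^ 2 +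
            2 * r ^ 2) := by
          gcongr
          exact (norm_sum_le _ _).trans (Finset.sum_le_sum fun b hb =>
            norm_vecMulVec_sub_le A (Z b) (W b) hA ha hr (hd b hb))
      _ = 2 * C * (a * Q + r * (1 + Q)) + 2 * a ^ 2 * Q + 2 * r ^ 2 := by
          have hcard : (S.card : ℝ) = B + 1 := by rw [hS, card_Icc_span hB]; simp
          simp only [Finset.sum_add_distrib, ← Finset.mul_sum, Finset.sum_const, hcard,
            nsmul_eq_mul]
          rw [hQ]
          field_simp
      _ ≤ _ := by gcongr

end Assembly

/-! ### Uniform consistency over the Fourier frequencies. -/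

section UniformConsistency

variable {Ω : Type*} [MeasurableSpace Ω] {μ : Measure Ω} [IsProbabilityMeasure μ] {K : ℕ}
  {N B : ℕ → ℕ} {H : (M : ℕ) → ℤ → Matrix (Fin M) (Fin K) ℂ} {ε : ℕ → ℤ → Ω → Fin K → ℂ}

theorem ae_tendsto_iSup_norm_smoothedPeriodogram_sub (h : HighDimRegime N B)
    (hH : FilterAssumption H) (hε : ∀ M : ℕ, 1 ≤ M → IsComplexGaussianWhiteNoise (ε M) μ)
    {u : (M : ℕ) → ℤ → Ω → Fin M → ℂ}
    (hu : ∀ M : ℕ, 1 ≤ M → IsFilterOutput (H M) (ε M) (u M) μ) :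
    ∀ᵐ ω ∂μ, Tendsto (fun M : ℕ => ⨆ k : Fin (N M),
      ‖smoothedPeriodogram (N M) (B M) (fun n => u M n ω) ((k : ℝ) / (N M : ℝ)) -
        transferFunction (H M) ((k : ℝ) / (N M : ℝ)) *
          (transferFunction (H M) ((k : ℝ) / (N M : ℝ)))ᴴ‖) atTop (𝓝 0) := by
  obtain ⟨C₀, hC₀⟩ := hH.memory
  set C := max C₀ 0 with hCdef
  have hC0 : 0 ≤ C := le_max_right _ _
  filter_upwards [ae_exists_tendsto_smoothedPeriodogram_sub_one h hε,
    ae_exists_tendsto_finiteFourier_sub h hH hε hu] with ω ⟨e, he, he'⟩ ⟨r, hr, hr0, hr'⟩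
  -- Lipschitz constant `2πC` times a bound `B / N` on the distance to the window's centre.
  set a : ℕ → ℝ := fun M => 2 * Real.pi * ((B M : ℝ) / N M) * C with ha
  have ha0 : ∀ M, 0 ≤ a M := fun M => by positivity
  have hat : Tendsto a atTop (𝓝 0) := by
    have := (h.tendsto_span_div.const_mul (2 * Real.pi)).mul_const C
    simpa using this
  have hlim : Tendsto (fun M => C ^ 2 * e M + (2 * C * (a M * (K + e M) +
      r M * (1 + (K + e M))) + 2 * a M ^ 2 * (K + e M) + 2 * r M ^ 2)) atTop (𝓝 0) := by
    have hK : Tendsto (fun M => (K : ℝ) + e M) atTop (𝓝 (K + 0)) := he.const_add _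
    have := (he.const_mul (C ^ 2)).add ((((hat.mul hK).add (hr.mul (hK.const_add 1))).const_mul
      (2 * C)).add (((hat.pow 2).const_mul 2).mul hK) |>.add ((hr.pow 2).const_mul 2))
    simpa using this
  refine squeeze_zero' (Eventually.of_forall fun M => Real.iSup_nonneg fun k => norm_nonneg _) ?_
    hlim
  filter_upwards [hr', h.eventually_span_lt, eventually_ge_atTop 1] with M h1 h2 h3
  have hNr : (0 : ℝ) < N M := by exact_mod_cast h2.1
  obtain ⟨hmem, hle⟩ := hC₀ M h3
  have hle' := hle.trans (le_max_left C₀ 0)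
  have hbound : ∀ k : Fin (N M),
      ‖smoothedPeriodogram (N M) (B M) (fun n => u M n ω) ((k : ℝ) / (N M : ℝ)) -
        transferFunction (H M) ((k : ℝ) / (N M : ℝ)) *
          (transferFunction (H M) ((k : ℝ) / (N M : ℝ)))ᴴ‖ ≤
      C ^ 2 * e M + (2 * C * (a M * (K + e M) +
      r M * (1 + (K + e M))) + 2 * a M ^ 2 * (K + e M) + 2 * r M ^ 2) := by
    intro k
    refine norm_smoothedPeriodogram_sub_le (h.even_span M h3) (fun n => ε M n ω) _ _ _
      ((norm_transferFunction_le hmem _).trans hle') (ha0 M) (hr0 M) (fun b hb => ?_) (he' M k)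
    set ν := (k : ℝ) / (N M : ℝ)
    set z := finiteFourier (N M) (fun n => ε M n ω) (ν + (b : ℝ) / (N M : ℝ))
    set w := finiteFourier (N M) (fun n => u M n ω) (ν + (b : ℝ) / (N M : ℝ))
    have hsplit : w - transferFunction (H M) ν *ᵥ z =
        (transferFunction (H M) (ν + (b : ℝ) / (N M : ℝ)) - transferFunction (H M) ν) *ᵥ z +
          (w - transferFunction (H M) (ν + (b : ℝ) / (N M : ℝ)) *ᵥ z) := by
      rw [Matrix.sub_mulVec]; abel
    rw [hsplit, WithLp.toLp_add]
    refine (norm_add_le _ _).trans (add_le_add ((norm_toLp_mulVec_le _ _).trans ?_) (h1 _))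
    gcongr
    refine (norm_transferFunction_sub_le hmem _ _).trans ?_
    simp only [ha]
    gcongr
    rw [add_sub_cancel_left, abs_div, abs_of_pos hNr]
    gcongr
    rw [Finset.mem_Icc] at hb
    have : |b| ≤ (B M : ℤ) := by rw [abs_le]; omega
    exact_mod_cast this
  refine Real.iSup_le hbound ?_
  -- `Real.iSup_le` requires a nonnegative bound; the frequency `k = 0`, available since `N M > 0`,
  -- supplies it.
  exact (norm_nonneg _).trans (hbound ⟨0, h2.1⟩)

end UniformConsistency

/-! ### Termwise integration of almost surely convergent series. -/

section SumsOfIntegrable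

variable {Ω : Type*} [MeasurableSpace Ω] {μ : Measure Ω} {ι : Type*} [Countable ι] {F : ι → Ω → ℂ}

theorem lintegral_tsum_enorm_ne_top (hF : ∀ i, Integrable (F i) μ)
    (hs : Summable fun i => ∫ ω, ‖F i ω‖ ∂μ) : ∫⁻ ω, ∑' i, ‖F i ω‖ₑ ∂μ ≠ ⊤ := by
  rw [lintegral_tsum fun i => (hF i).1.enorm]
  simp_rw [fun i => (ofReal_integral_norm_eq_lintegral_enorm (hF i)).symm]
  rw [← ENNReal.ofReal_tsum_of_nonneg (fun i => integral_nonneg fun _ => norm_nonneg _) hs]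
  exact ENNReal.ofReal_ne_top

theorem ae_summable_norm_of_summable_integral (hF : ∀ i, Integrable (F i) μ)
    (hs : Summable fun i => ∫ ω, ‖F i ω‖ ∂μ) : ∀ᵐ ω ∂μ, Summable fun i => ‖F i ω‖ := by
  filter_upwards [ae_lt_top' (AEMeasurable.tsum fun i => (hF i).1.enorm)
    (lintegral_tsum_enorm_ne_top hF hs)] with ω hω
  have := ENNReal.summable_toReal hω.ne
  simpa using this

/-- Measurability of `v` is inherited from the series, with which it agrees almost everywhere. -/
theorem integrable_and_hasSum_integral (hF : ∀ i, Integrable (F i) μ)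
    (hs : Summable fun i => ∫ ω, ‖F i ω‖ ∂μ) {v : Ω → ℂ}
    (hv : ∀ᵐ ω ∂μ, HasSum (fun i => F i ω) (v ω)) :
    Integrable v μ ∧ HasSum (fun i => ∫ ω, F i ω ∂μ) (∫ ω, v ω ∂μ) := by
  have hve : v =ᵐ[μ] fun ω => ∑' i, F i ω := by
    filter_upwards [hv] with ω hω using hω.tsum_eq.symm
  constructor
  · rw [integrable_congr hve]
    refine ⟨(AEMeasurable.tsum fun i => (hF i).1.aemeasurable).aestronglyMeasurable, ?_⟩
    refine lt_of_le_of_lt (lintegral_mono_ae ?_)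
      (lt_top_iff_ne_top.2 (lintegral_tsum_enorm_ne_top hF hs))
    filter_upwards [hv] with ω hω
    exact enorm_tsum_le_tsum_enorm
  · rw [integral_congr_ae hve]
    exact hasSum_integral_of_summable_integral_norm hF hs

end SumsOfIntegrable

/-! ### Autocovariance and spectral density of the filter output. -/

section SpectralDensity

variable {M K : ℕ} {H : ℤ → Matrix (Fin M) (Fin K) ℂ}

theorem norm_apply_le_l2_opNorm {m n : ℕ} (A : Matrix (Fin m) (Fin n) ℂ) (i : Fin m) (j : Fin n) :
    ‖A i j‖ ≤ ‖A‖ := by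
  have h := norm_toLp_mulVec_le A (Pi.single j 1)
  have h2 : ‖WithLp.toLp 2 (Pi.single j 1 : Fin n → ℂ)‖ = 1 := by
    change ‖EuclideanSpace.single j (1 : ℂ)‖ = 1
    simp
  rw [h2, mul_one] at h
  refine le_trans ?_ h
  have := PiLp.norm_apply_le (WithLp.toLp 2 (A *ᵥ Pi.single j 1)) i
  simpa using this

theorem Summable.norm_mul_norm {α β E F : Type*} [SeminormedAddCommGroup E]
    [SeminormedAddCommGroup F] {f : α → E} {g : β → F} (hf : Summable fun a => ‖f a‖)
    (hg : Summable fun b => ‖g b‖) : Summable fun p : α × β => ‖f p.1‖ * ‖g p.2‖ :=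
  Summable.mul_of_nonneg (f := fun a => ‖f a‖) (g := fun b => ‖g b‖) hf hg
    (fun a => norm_nonneg (f a)) (fun b => norm_nonneg (g b))

theorem hasSum_mul_star {α β : Type*} {f : α → ℂ} {g : β → ℂ} {s t : ℂ} (hf : HasSum f s)
    (hg : HasSum g t) (hf' : Summable fun a => ‖f a‖) (hg' : Summable fun b => ‖g b‖) :
    HasSum (fun p : α × β => f p.1 * star (g p.2)) (s * star t) :=
  HasSum.mul (f := f) (g := fun b => star (g b)) hf hg.star
    (summable_mul_of_summable_norm (f := f) (g := fun b => star (g b)) hf'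
      (by simpa only [norm_star] using hg'))

/-- The autocovariance `∑_k H_k H_{k-ℓ}^*` of the output of the filter `(H_k)`. -/
noncomputable def filterAutocovariance (H : ℤ → Matrix (Fin M) (Fin K) ℂ) (l : ℤ) :
    Matrix (Fin M) (Fin M) ℂ :=
  ∑' k : ℤ, H k * (H (k - l))ᴴ

theorem hasSum_filterAutocovariance (hH : Summable fun k => ‖H k‖) (l : ℤ) :
    HasSum (fun k : ℤ => H k * (H (k - l))ᴴ) (filterAutocovariance H l) := by
  refine Summable.hasSum (Summable.of_norm_bounded (g := fun k => ‖H k‖ * ‖H (k - l)‖) ?_ ?_)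
  · have hi : Function.Injective fun k : ℤ => (k, k - l) := fun a b hab => (Prod.ext_iff.1 hab).1
    have h := (Summable.norm_mul_norm (f := H) (g := H) hH hH).comp_injective hi
    exact h
  · intro k
    refine (Matrix.l2_opNorm_mul _ _).trans_eq ?_
    rw [Matrix.l2_opNorm_conjTranspose]

theorem HasSum.matrix_mul_prod {A : ℤ → Matrix (Fin M) (Fin K) ℂ}
    {D : ℤ → Matrix (Fin K) (Fin M) ℂ} {a : Matrix (Fin M) (Fin K) ℂ}
    {d : Matrix (Fin K) (Fin M) ℂ} (hA : HasSum A a) (hD : HasSum D d)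
    (hA' : Summable fun k => ‖A k‖) (hD' : Summable fun k => ‖D k‖) :
    HasSum (fun p : ℤ × ℤ => A p.1 * D p.2) (a * d) := by
  have hs : Summable fun p : ℤ × ℤ => A p.1 * D p.2 :=
    Summable.of_norm_bounded (Summable.norm_mul_norm (f := A) (g := D) hA' hD') fun p =>
      Matrix.l2_opNorm_mul (A p.1) (D p.2)
  have h1 : HasSum (fun k => A k * d) (∑' p : ℤ × ℤ, A p.1 * D p.2) := by
    refine hs.hasSum.prod_fiberwise fun k => ?_
    exact hD.map (AddMonoidHom.mk' (fun X => A k * X) (Matrix.mul_add _))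
      (continuous_const.matrix_mul continuous_id)
  have h2 : HasSum (fun k => A k * d) (a * d) :=
    hA.map (AddMonoidHom.mk' (fun X => X * d) (fun X Y => Matrix.add_mul X Y d))
      (continuous_id.matrix_mul continuous_const)
  rw [h2.unique h1]
  exact hs.hasSum

/-- The absolutely convergent double series of `H(ν) H(ν)^*` is summed along the lines `k - k' = l`,
on which the phases combine into the single phase of `l`. -/
theorem hasSum_exp_smul_filterAutocovariance (hH : Summable fun k => ‖H k‖) (ν : ℝ) :
    HasSum (fun l : ℤ => Complex.exp (-(2 * (Real.pi : ℂ) * Complex.I * (ν : ℂ) * (l : ℂ))) •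
      filterAutocovariance H l) (transferFunction H ν * (transferFunction H ν)ᴴ) := by
  set e : ℤ → ℂ := fun n => Complex.exp (-(2 * (Real.pi : ℂ) * Complex.I * (ν : ℂ) * (n : ℂ)))
    with he
  have hne : ∀ n, ‖e n‖ = 1 := fun n => by
    have := norm_exp_neg_two_pi_mul ν n
    rwa [Complex.ofReal_intCast] at this
  have hee : ∀ k l, e k * star (e (k - l)) = e l := by
    intro k l
    simp only [he]
    rw [Complex.star_def, ← Complex.exp_conj, ← Complex.exp_add]
    congr 1
    simp only [map_neg, map_mul, Complex.conj_I, Complex.conj_ofReal, map_ofNat, map_intCast]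
    push_cast
    ring
  have h1 : HasSum (fun k => e k • H k) (transferFunction H ν) := hasSum_transferFunction hH ν
  have h2 : HasSum (fun k => (e k • H k)ᴴ) (transferFunction H ν)ᴴ := h1.matrix_conjTranspose
  have h3 := h1.matrix_mul_prod h2 (by simpa [norm_smul, hne] using hH)
    (by simpa [norm_smul, hne, Matrix.l2_opNorm_conjTranspose] using hH)
  let φ : ℤ × ℤ ≃ ℤ × ℤ :=
    { toFun := fun p => (p.2, p.2 - p.1)
      invFun := fun p => (p.1 - p.2, p.1)
      left_inv := fun p => by simp
      right_inv := fun p => by simp }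
  have h4 := (φ.hasSum_iff).2 h3
  refine h4.prod_fiberwise fun l => ?_
  refine ((hasSum_filterAutocovariance hH l).const_smul (e l)).congr_fun fun k => ?_
  simp only [φ, Function.comp_apply, Equiv.coe_fn_mk]
  rw [Matrix.conjTranspose_smul, Matrix.smul_mul, Matrix.mul_smul, smul_smul, hee]

variable {Ω : Type*} [MeasurableSpace Ω] {μ : Measure Ω} {ε : ℤ → Ω → Fin K → ℂ}
  {u : ℤ → Ω → Fin M → ℂ}

theorem summable_norm_fst (hH : Summable fun k => ‖H k‖) :
    Summable fun p : ℤ × Fin K => ‖H p.1‖ := by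
  have := Summable.norm_mul_norm (f := H) (g := fun _ : Fin K => (1 : ℝ)) hH Summable.of_finite
  simpa using this

theorem integrable_filter_term (hε : IsComplexGaussianWhiteNoise ε μ) (n : ℤ) (i : Fin M)
    (p : ℤ × Fin K) : Integrable (fun ω => H p.1 i p.2 * ε (n - p.1) ω p.2) μ :=
  (hε.law _ _).hasGaussianLaw.integrable.const_mul _

theorem summable_integral_norm_filter_term (hε : IsComplexGaussianWhiteNoise ε μ)
    (hH : Summable fun k => ‖H k‖) (n : ℤ) (i : Fin M) :
    Summable fun p : ℤ × Fin K => ∫ ω, ‖H p.1 i p.2 * ε (n - p.1) ω p.2‖ ∂μ := by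
  refine Summable.of_nonneg_of_le (fun p => integral_nonneg fun _ => norm_nonneg _) (fun p => ?_)
    ((summable_norm_fst hH).mul_right (∫ z : ℂ, ‖z‖ ∂stdComplexGaussian))
  simp_rw [norm_mul]
  rw [integral_const_mul]
  have : ∫ ω, ‖ε (n - p.1) ω p.2‖ ∂μ = ∫ z : ℂ, ‖z‖ ∂stdComplexGaussian :=
    (hε.law _ _).integral_comp (f := fun z => ‖z‖) (by fun_prop)
  rw [this]
  gcongr
  exact norm_apply_le_l2_opNorm _ _ _

/-- Flattening the vector series to scalar terms indexed by lag and coordinate gives absolute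
summability, which permits multiplying two such series. -/
theorem ae_hasSum_filter_term (hε : IsComplexGaussianWhiteNoise ε μ)
    (hH : Summable fun k => ‖H k‖) (hu : IsFilterOutput H ε u μ) (n : ℤ) (i : Fin M) :
    ∀ᵐ ω ∂μ, HasSum (fun p : ℤ × Fin K => H p.1 i p.2 * ε (n - p.1) ω p.2) (u n ω i) ∧
      Summable fun p : ℤ × Fin K => ‖H p.1 i p.2 * ε (n - p.1) ω p.2‖ := by
  filter_upwards [hu n, ae_summable_norm_of_summable_integral
    (fun p => integrable_filter_term hε n i p)
    (summable_integral_norm_filter_term hε hH n i)] with ω h1 h2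
  refine ⟨?_, h2⟩
  have h3 := h2.of_norm.hasSum
  have h4 := h3.prod_fiberwise fun k => hasSum_fintype _
  have h5 := Pi.hasSum.1 h1 i
  rw [h5.unique h4]
  exact h3

theorem integral_filter_term_mul_star (hε : IsComplexGaussianWhiteNoise ε μ) (n l : ℤ)
    (i j : Fin M) (p q : ℤ × Fin K) :
    ∫ ω, (H p.1 i p.2 * ε (n - p.1) ω p.2) * star (H q.1 j q.2 * ε (n - l - q.1) ω q.2) ∂μ =
      if q = (p.1 - l, p.2) then H p.1 i p.2 * star (H q.1 j q.2) else 0 := by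
  simp_rw [star_mul', fun ω => mul_mul_mul_comm (H p.1 i p.2) (ε (n - p.1) ω p.2)
    (star (H q.1 j q.2)) (star (ε (n - l - q.1) ω q.2))]
  rw [integral_const_mul]
  have := integral_mul_star_of_iIndepFun (X := fun (p : ℤ × Fin K) ω => ε p.1 ω p.2)
    (fun p => hε.law _ _) hε.indep (n - p.1, p.2) (n - l - q.1, q.2)
  rw [this]
  have hiff : ((n - p.1, p.2) : ℤ × Fin K) = (n - l - q.1, q.2) ↔ q = (p.1 - l, p.2) := by
    obtain ⟨q1, q2⟩ := q
    simp only [Prod.mk.injEq]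
    constructor
    · rintro ⟨h1, h2⟩; exact ⟨by omega, h2.symm⟩
    · rintro ⟨h1, h2⟩; exact ⟨by omega, h2.symm⟩
  simp only [hiff]
  split_ifs <;> simp

theorem IsComplexGaussianWhiteNoise.integrable_mul_star (hε : IsComplexGaussianWhiteNoise ε μ)
    (n m : ℤ) (i j : Fin K) : Integrable (fun ω => ε n ω i * star (ε m ω j)) μ :=
  (memLp_two_of_hasLaw (hε.law n i)).integrable_mul (memLp_two_of_hasLaw (hε.law m j)).star

theorem integrable_filter_term_mul_star (hε : IsComplexGaussianWhiteNoise ε μ) (n m : ℤ)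
    (i j : Fin M) (p q : ℤ × Fin K) :
    Integrable (fun ω => (H p.1 i p.2 * ε (n - p.1) ω p.2) *
      star (H q.1 j q.2 * ε (m - q.1) ω q.2)) μ := by
  simp_rw [star_mul', fun ω => mul_mul_mul_comm (H p.1 i p.2) (ε (n - p.1) ω p.2)
    (star (H q.1 j q.2)) (star (ε (m - q.1) ω q.2))]
  exact (hε.integrable_mul_star _ _ _ _).const_mul _

theorem summable_integral_norm_filter_term_mul_star (hε : IsComplexGaussianWhiteNoise ε μ)
    (hH : Summable fun k => ‖H k‖) (n m : ℤ) (i j : Fin M) :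
    Summable fun p : (ℤ × Fin K) × (ℤ × Fin K) =>
      ∫ ω, ‖(H p.1.1 i p.1.2 * ε (n - p.1.1) ω p.1.2) *
        star (H p.2.1 j p.2.2 * ε (m - p.2.1) ω p.2.2)‖ ∂μ := by
  set V := (2 * ∫⁻ z : ℂ, ‖z‖ₑ ^ 2 ∂stdComplexGaussian).toReal
  have hs := (Summable.norm_mul_norm (f := fun p : ℤ × Fin K => H p.1)
    (g := fun p : ℤ × Fin K => H p.1) (summable_norm_fst hH) (summable_norm_fst hH)).mul_right V
  refine Summable.of_nonneg_of_le (fun p => integral_nonneg fun _ => norm_nonneg _) (fun p => ?_) hs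
  have e : ∀ ω, ‖(H p.1.1 i p.1.2 * ε (n - p.1.1) ω p.1.2) *
        star (H p.2.1 j p.2.2 * ε (m - p.2.1) ω p.2.2)‖ = (‖H p.1.1 i p.1.2‖ * ‖H p.2.1 j p.2.2‖) *
        ‖ε (n - p.1.1) ω p.1.2 * star (ε (m - p.2.1) ω p.2.2)‖ := fun ω => by
    simp only [norm_mul, norm_star]; ring
  simp_rw [e]
  rw [integral_const_mul]
  have hV : ∫ ω, ‖ε (n - p.1.1) ω p.1.2 * star (ε (m - p.2.1) ω p.2.2)‖ ∂μ ≤ V := by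
    rw [integral_norm_eq_lintegral_enorm (hε.integrable_mul_star _ _ _ _).1]
    refine ENNReal.toReal_mono (ENNReal.mul_ne_top (by simp)
      lintegral_enorm_sq_stdComplexGaussian_ne_top) ?_
    refine le_trans (le_of_eq ?_) (hε.lintegral_enorm_mul_enorm_le (n - p.1.1) (m - p.2.1) p.1.2
      p.2.2)
    refine lintegral_congr fun ω => ?_
    rw [enorm_mul]
    congr 1
    rw [← ofReal_norm, norm_star, ofReal_norm]
  have h1 := norm_apply_le_l2_opNorm (H p.1.1) i p.1.2
  have h2 := norm_apply_le_l2_opNorm (H p.2.1) j p.2.2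
  have hnn : 0 ≤ ∫ ω, ‖ε (n - p.1.1) ω p.1.2 * star (ε (m - p.2.1) ω p.2.2)‖ ∂μ :=
    integral_nonneg fun _ => norm_nonneg _
  gcongr

theorem integral_mul_star_filterOutput (hε : IsComplexGaussianWhiteNoise ε μ)
    (hH : Summable fun k => ‖H k‖) (hu : IsFilterOutput H ε u μ) (n l : ℤ) (i j : Fin M) :
    Integrable (fun ω => u n ω i * star (u (n - l) ω j)) μ ∧
      ∫ ω, u n ω i * star (u (n - l) ω j) ∂μ = filterAutocovariance H l i j := by
  have hsum : ∀ᵐ ω ∂μ, HasSum (fun p : (ℤ × Fin K) × (ℤ × Fin K) =>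
      (H p.1.1 i p.1.2 * ε (n - p.1.1) ω p.1.2) *
        star (H p.2.1 j p.2.2 * ε (n - l - p.2.1) ω p.2.2)) (u n ω i * star (u (n - l) ω j)) := by
    filter_upwards [ae_hasSum_filter_term hε hH hu n i, ae_hasSum_filter_term hε hH hu (n - l) j]
      with ω h1 h2
    exact hasSum_mul_star (f := fun p : ℤ × Fin K => H p.1 i p.2 * ε (n - p.1) ω p.2)
      (g := fun p : ℤ × Fin K => H p.1 j p.2 * ε (n - l - p.1) ω p.2) h1.1 h2.1 h1.2 h2.2
  obtain ⟨h1, h2⟩ := integrable_and_hasSum_integral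
    (fun p : (ℤ × Fin K) × (ℤ × Fin K) =>
      integrable_filter_term_mul_star (H := H) hε n (n - l) i j p.1 p.2)
    (summable_integral_norm_filter_term_mul_star hε hH n (n - l) i j) hsum
  refine ⟨h1, ?_⟩
  simp_rw [integral_filter_term_mul_star hε] at h2
  -- By whiteness only the graph `q = (p.1 - l, p.2)` contributes to the double sum.
  let g : ℤ × Fin K → (ℤ × Fin K) × (ℤ × Fin K) := fun p => (p, (p.1 - l, p.2))
  have hg : Function.Injective g := fun a b hab => (Prod.ext_iff.1 hab).1
  rw [← hg.hasSum_iff (fun x hx => by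
    rw [if_neg]
    intro h
    exact hx ⟨x.1, Prod.ext rfl h.symm⟩)] at h2
  have h3 := h2.prod_fiberwise fun k => hasSum_fintype _
  have h4 := Pi.hasSum.1 (Pi.hasSum.1 (hasSum_filterAutocovariance hH l) i) j
  refine h3.unique (h4.congr_fun fun k => ?_)
  simp [g, Matrix.mul_apply]

theorem hasSpectralDensity_filterOutput (hε : IsComplexGaussianWhiteNoise ε μ)
    (hH : Summable fun k => ‖H k‖) (hu : IsFilterOutput H ε u μ) :
    HasSpectralDensity u (fun ν => transferFunction H ν * (transferFunction H ν)ᴴ) μ := by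
  refine ⟨fun n i => ?_, filterAutocovariance H,
    fun n l i j => integral_mul_star_filterOutput hε hH hu n l i j,
    hasSum_exp_smul_filterAutocovariance hH⟩
  obtain ⟨h1, h2⟩ := integrable_and_hasSum_integral (fun p => integrable_filter_term hε n i p)
    (summable_integral_norm_filter_term hε hH n i)
    ((ae_hasSum_filter_term hε hH hu n i).mono fun ω h => h.1)
  refine ⟨h1, h2.unique ?_⟩
  have : ∀ p : ℤ × Fin K, ∫ ω, H p.1 i p.2 * ε (n - p.1) ω p.2 ∂μ = 0 := fun p => by
    rw [integral_const_mul, integral_eq_zero_of_hasLaw (hε.law _ _), mul_zero]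
  simp_rw [this]
  exact hasSum_zero

end SpectralDensity

/-! ### Conclusion. -/

theorem mainTheorem7 {Ω : Type*} [MeasurableSpace Ω] (μ : Measure Ω) [IsProbabilityMeasure μ]
    (K : ℕ) (N B : ℕ → ℕ) (hregime : HighDimRegime N B)
    (H : (M : ℕ) → ℤ → Matrix (Fin M) (Fin K) ℂ) (hH : FilterAssumption H)
    (ε : ℕ → ℤ → Ω → Fin K → ℂ)
    (hε : ∀ M : ℕ, 1 ≤ M → IsComplexGaussianWhiteNoise (ε M) μ)
    (u : (M : ℕ) → ℤ → Ω → Fin M → ℂ)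
    (hu : ∀ M : ℕ, 1 ≤ M → IsFilterOutput (H M) (ε M) (u M) μ) :
    (∀ M : ℕ, 1 ≤ M →
      HasSpectralDensity (u M)
        (fun ν => transferFunction (H M) ν * (transferFunction (H M) ν)ᴴ) μ ∧
      ∀ ν : ℝ, (transferFunction (H M) ν * (transferFunction (H M) ν)ᴴ).rank ≤ K) ∧
    ∀ᵐ ω ∂μ, Tendsto (fun M : ℕ => ⨆ k : Fin (N M),
      ‖smoothedPeriodogram (N M) (B M) (fun n => u M n ω) ((k : ℝ) / (N M : ℝ)) -
        transferFunction (H M) ((k : ℝ) / (N M : ℝ)) *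
          (transferFunction (H M) ((k : ℝ) / (N M : ℝ)))ᴴ‖) atTop (𝓝 0) := by
  refine ⟨fun M hM => ⟨?_, fun ν => ?_⟩, ae_tendsto_iSup_norm_smoothedPeriodogram_sub hregime hH hε hu⟩
  · obtain ⟨C, hC⟩ := hH.memory
    exact hasSpectralDensity_filterOutput (hε M hM)
      (summable_norm_of_summable_memory (hC M hM).1) (hu M hM)
  · exact (Matrix.rank_mul_le_left _ _).trans (Matrix.rank_le_width _)
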